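/- Let $K$ be an infinite field (of any characteristic), $G=PSL(2,K)$, and let $X$ be the full simplex whose vertex set is the projective line $\mathbf P^1(K)$: the $n$-simplices of $X$ are spanned by the $(n+1)$-tuples of pairwise distinct points. Let $C_*$ be its simplicial chain complex, that is, $C_n$ is the abelian group generated by the ordered $n$-simplices subject to $t\sigma=\operatorname{sgn}(t)\,\sigma$ for all permutations $t$ of the vertices, with $\partial[v_0,\dots,v_n]=\sum_i(-1)^i[v_0,\dots,\widehat{v_i},\dots,v_n]$. Put $B_2=\partial C_3$ and let $U_2=(C_2/B_2)_G$ be the group of coinvariants. Let $W(K)$ be the Witt group of $K$: the quotient of the Grothendieck group $\widehat W(K)$ of isometry classes of non-degenerate symmetric bilinear forms on finite-dimensional $K$-vector spaces (under orthogonal sum) by the ideal (for the tensor product) generated by the hyperbolic plane $\begin{pmatrix}0&1\\1&0\end{pmatrix}$. Write $\dot K=K\setminus\{0\}$ and let $[a]$ be the generator of $\mathbf Z[\dot K/\dot K^2]$ given by the class of $a\in\dot K$. Then $U_2$ is isomorphic to $W(K)$. More precisely: 1. For a triple $([u],[v],[w])$ of pairwise distinct points, the class in $\dot K/\dot K^2$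 of $\det(u,v)\det(v,w)\det(w,u)$ is well defined. It takes every value in $\dot K/\dot K^2$, and two triples have the same class if and only if they are in the same $G$-orbit. Call the corresponding generator of $\mathbf Z[\dot K/\dot K^2]$ the symbol of the triple. 2. Under the induced map from ordered $2$-chains to $\mathbf Z[\dot K/\dot K^2]$, the boundaries of the ordered $3$-simplices become exactly the elements $[a]+[b]-[a+b]-[ab(a+b)]$ with $a,b,a+b\in\dot K$, and the alternation relators $t\sigma-\operatorname{sgn}(t)\sigma$ generate the same subgroup as the elements $[-a]+[a]$, $a\in\dot K$. 3. The homomorphism $\mathbf Z[\dot K/\dot K^2]\to U_2$ that sends the symbol of a triple to the class of the triple is well defined and surjective, and its kernel is generated by the elements in 2. Thus $U_2$ is presented by the generators $[a]$, $a\in\dot K/\dot K^2$, and the relations $[a]+[b]=[a+b]+[ab(a+b)]$ (for $a,b,a+b\in\dot K$) and $[-a]=-[a]$. 4. There is an isomorphism $U_2\to W(K)$ that sends the image of $[a]$ to the Witt class of the one-dimensional form $\langle a\rangle\colon (x,y)\mapsto axy$, for every $a\in\dot K$. -/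

import Mathlib

universe u

open scoped LinearAlgebra.Projectivization TensorProduct

noncomputable section

namespace SimplexWitt

/-! ### The simplicial chain complex of a full simplex -/

section Chains

variable (V : Type*) (n : ℕ)

/-- Non-degenerate ordered `n`-simplices of the full simplex with vertex set `V`:
`(n+1)`-tuples of pairwise distinct vertices. -/
abbrev OrderedSimplex : Type _ := Fin (n + 1) ↪ V

/-- Ordered `n`-chains: the free abelian group on the ordered `n`-simplices. -/
abbrev OrderedChain : Type _ := OrderedSimplex V n →₀ ℤ

variable {V n}

/-- The `i`-th face `[v₀, …, v̂ᵢ, …, vₙ₊₁]` of `[v₀, …, vₙ₊₁]`. -/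
def face (i : Fin (n + 2)) (σ : OrderedSimplex V (n + 1)) : OrderedSimplex V n :=
  (Fin.succAboveEmb i).trans σ

/-- The simplex `[v_{t 0}, …, v_{t n}]` obtained by permuting the vertices of `[v₀, …, vₙ]`. -/
def permute (t : Equiv.Perm (Fin (n + 1))) (σ : OrderedSimplex V n) : OrderedSimplex V n :=
  t.toEmbedding.trans σ

/-- The element `tσ - sgn(t)σ` of the ordered chain group. -/
def alternationRelator (t : Equiv.Perm (Fin (n + 1))) (σ : OrderedSimplex V n) :
    OrderedChain V n :=
  Finsupp.single (permute t σ) 1 - (Equiv.Perm.sign t : ℤ) • Finsupp.single σ 1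

variable (V n)

/-- The subgroup of ordered chains spanned by all `tσ - sgn(t)σ`. -/
def alternation : Submodule ℤ (OrderedChain V n) :=
  Submodule.span ℤ (Set.range fun p : Equiv.Perm (Fin (n + 1)) × OrderedSimplex V n =>
    alternationRelator p.1 p.2)

/-- The boundary of ordered chains,
`∂[v₀, …, vₙ₊₁] = ∑ᵢ (-1)ⁱ [v₀, …, v̂ᵢ, …, vₙ₊₁]`. -/
def orderedBoundary : OrderedChain V (n + 1) →ₗ[ℤ] OrderedChain V n :=
  Finsupp.linearCombination ℤ fun σ =>
    ∑ i : Fin (n + 2), (-1 : ℤ) ^ (i : ℕ) • Finsupp.single (face i σ) (1 : ℤ)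

/-- The group `Cₙ` of (oriented) simplicial `n`-chains of the full simplex on `V`: generated by
the ordered `n`-simplices, with a change of the order of the vertices acting through the sign. -/
abbrev Chain : Type _ := OrderedChain V n ⧸ alternation V n

variable {V n}

/-- The chain of an ordered simplex. -/
def chainOf (σ : OrderedSimplex V n) : Chain V n :=
  (alternation V n).mkQ (Finsupp.single σ 1)

lemma chainOf_permute (t : Equiv.Perm (Fin (n + 1))) (σ : OrderedSimplex V n) :
    chainOf (permute t σ) = (Equiv.Perm.sign t : ℤ) • chainOf σ := by
  rw [chainOf, chainOf, ← map_smul, ← sub_eq_zero, ← map_sub]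
  simp only [Submodule.mkQ_apply, Submodule.Quotient.mk_eq_zero]
  exact Submodule.subset_span ⟨(t, σ), rfl⟩

lemma mkQ_orderedBoundary_single (σ : OrderedSimplex V (n + 1)) :
    (alternation V n).mkQ (orderedBoundary V n (Finsupp.single σ 1)) =
      ∑ i : Fin (n + 2), (-1 : ℤ) ^ (i : ℕ) • chainOf (face i σ) := by
  simp only [orderedBoundary, Finsupp.linearCombination_single, one_smul, map_sum, map_smul]
  rfl

lemma face_permute_swap (i : Fin (n + 1)) (σ : OrderedSimplex V (n + 1)) :
    face i.castSucc (permute (Equiv.swap i.castSucc i.succ) σ) = face i.succ σ ∧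
      face i.succ (permute (Equiv.swap i.castSucc i.succ) σ) = face i.castSucc σ := by
  have key : ∀ k : Fin (n + 1),
      Equiv.swap i.castSucc i.succ (i.castSucc.succAbove k) = i.succ.succAbove k := by
    intro k
    rcases lt_trichotomy k i with h | h | h
    · rw [Fin.succAbove_castSucc_of_lt _ _ h,
        Fin.succAbove_of_castSucc_lt i.succ k (Fin.castSucc_lt_succ_iff.2 h.le), Equiv.swap_apply_of_ne_of_ne]
      · simpa using h.ne
      · intro h'
        have := congrArg Fin.val h'
        have h2 : (k : ℕ) < i := h
        simp at this; omega
    · subst h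
      simp
    · rw [Fin.succAbove_castSucc_of_le _ _ h.le, Fin.succAbove_of_le_castSucc,
        Equiv.swap_apply_of_ne_of_ne]
      · intro h'
        have := congrArg Fin.val h'
        have h2 : (i : ℕ) < k := h
        simp at this; omega
      · simpa using h.ne'
      · simpa [Fin.le_def] using h
  constructor
  · ext k
    simp only [face, permute, Function.Embedding.trans_apply, Equiv.coe_toEmbedding]
    exact congrArg σ (key k)
  · ext k
    simp only [face, permute, Function.Embedding.trans_apply, Equiv.coe_toEmbedding]
    refine congrArg σ ?_
    have := congrArg (Equiv.swap i.castSucc i.succ) (key k)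
    rw [Equiv.swap_apply_self] at this
    exact this.symm

lemma chainOf_face_permute_swap (i : Fin (n + 1)) (j : Fin (n + 2)) (h1 : j ≠ i.castSucc)
    (h2 : j ≠ i.succ) (σ : OrderedSimplex V (n + 1)) :
    chainOf (face j (permute (Equiv.swap i.castSucc i.succ) σ)) = -chainOf (face j σ) := by
  obtain ⟨a, ha⟩ := Fin.exists_succAbove_eq h1.symm
  obtain ⟨b, hb⟩ := Fin.exists_succAbove_eq h2.symm
  have hab : a ≠ b := by
    rintro rfl
    rw [ha] at hb
    exact absurd hb (by simp [Fin.ext_iff])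
  have : face j (permute (Equiv.swap i.castSucc i.succ) σ) =
      permute (Equiv.swap a b) (face j σ) := by
    ext k
    simp only [face, permute, Function.Embedding.trans_apply, Equiv.coe_toEmbedding]
    refine congrArg σ ?_
    rw [← ha, ← hb]
    exact ((Fin.succAbove_right_injective (p := j)).map_swap a b k).symm
  rw [this, chainOf_permute, Equiv.Perm.sign_swap hab]
  simp

lemma mkQ_orderedBoundary_permute_swap (i : Fin (n + 1)) (σ : OrderedSimplex V (n + 1)) :
    (alternation V n).mkQ (orderedBoundary V n
      (Finsupp.single (permute (Equiv.swap i.castSucc i.succ) σ) 1)) =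
      -(alternation V n).mkQ (orderedBoundary V n (Finsupp.single σ 1)) := by
  rw [mkQ_orderedBoundary_single, mkQ_orderedBoundary_single, ← add_eq_zero_iff_eq_neg,
    ← Finset.sum_add_distrib]
  have hne : i.castSucc ≠ i.succ := by simp [Fin.ext_iff]
  rw [← Finset.add_sum_erase _ _ (Finset.mem_univ i.castSucc),
    ← Finset.add_sum_erase _ _ (Finset.mem_erase.2 ⟨hne.symm, Finset.mem_univ i.succ⟩),
    Finset.sum_eq_zero]
  · obtain ⟨h1, h2⟩ := face_permute_swap i σ
    rw [h1, h2]
    simp only [Fin.val_castSucc, Fin.val_succ, pow_succ]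
    module
  · intro j hj
    simp only [Finset.mem_erase, Finset.mem_univ, and_true] at hj
    rw [chainOf_face_permute_swap i j hj.2 hj.1]
    module

lemma mkQ_orderedBoundary_permute (t : Equiv.Perm (Fin (n + 2))) :
    ∀ σ : OrderedSimplex V (n + 1),
      (alternation V n).mkQ (orderedBoundary V n (Finsupp.single (permute t σ) 1)) =
        (Equiv.Perm.sign t : ℤ) •
          (alternation V n).mkQ (orderedBoundary V n (Finsupp.single σ 1)) := by
  have ht : t ∈ Submonoid.closure
      (Set.range fun i : Fin (n + 1) => Equiv.swap i.castSucc i.succ) := by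
    rw [Equiv.Perm.mclosure_swap_castSucc_succ]; trivial
  induction ht using Submonoid.closure_induction with
  | mem x hx =>
    obtain ⟨i, rfl⟩ := hx
    intro σ
    have hne : i.castSucc ≠ i.succ := by simp [Fin.ext_iff]
    simp only
    rw [mkQ_orderedBoundary_permute_swap, Equiv.Perm.sign_swap hne]
    simp
  | one =>
    intro σ
    have : permute (1 : Equiv.Perm (Fin (n + 2))) σ = σ := by ext k; rfl
    rw [this]; simp
  | mul x y _ _ hx hy =>
    intro σ
    have : permute (x * y) σ = permute y (permute x σ) := by ext k; rfl
    rw [this, hy, hx, Equiv.Perm.sign_mul, smul_smul, mul_comm]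
    simp

variable (V n)

/-- The boundary homomorphism `∂ : Cₙ₊₁ → Cₙ`. -/
def boundary : Chain V (n + 1) →ₗ[ℤ] Chain V n :=
  (alternation V (n + 1)).liftQ ((alternation V n).mkQ ∘ₗ orderedBoundary V n) <| by
    rw [alternation, Submodule.span_le]
    rintro _ ⟨⟨t, σ⟩, rfl⟩
    simp only [alternationRelator, SetLike.mem_coe, LinearMap.mem_ker, LinearMap.comp_apply,
      map_sub, map_smul]
    rw [mkQ_orderedBoundary_permute, sub_self]

end Chains

/-! ### The group action and the coefficient group -/

section Coefficients

variable (G : Type*) [Group G] (V : Type*) [MulAction G V] (n : ℕ)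

/-- The action of `G` on ordered chains induced by its action on the vertices. -/
def orderedRep : Representation ℤ G (OrderedChain V n) where
  toFun g := Finsupp.lmapDomain ℤ ℤ (g • ·)
  map_one' := by ext; simp
  map_mul' g h := by ext; simp [mul_smul]

lemma orderedRep_single (g : G) (σ : OrderedSimplex V n) (z : ℤ) :
    orderedRep G V n g (Finsupp.single σ z) = Finsupp.single (g • σ) z := by
  simp [orderedRep]

/-- The action of `G` on the simplicial chain group `Cₙ`. -/
def chainRep : Representation ℤ G (Chain V n) :=
  (orderedRep G V n).quotient (alternation V n) fun g => by
    rw [alternation, Submodule.span_le]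
    rintro _ ⟨⟨t, σ⟩, rfl⟩
    simp only [alternationRelator, Submodule.comap_coe, Set.mem_preimage, map_sub, map_smul,
      orderedRep_single]
    exact Submodule.subset_span ⟨(t, g • σ), rfl⟩

lemma chainRep_chainOf (g : G) (σ : OrderedSimplex V n) :
    chainRep G V n g (chainOf σ) = chainOf (g • σ) := by
  simp only [chainOf, ← orderedRep_single]
  rfl

lemma boundary_chainOf (σ : OrderedSimplex V (n + 1)) :
    boundary V n (chainOf σ) = ∑ i : Fin (n + 2), (-1 : ℤ) ^ (i : ℕ) • chainOf (face i σ) :=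
  mkQ_orderedBoundary_single σ

lemma boundary_equivariant (g : G) (c : Chain V (n + 1)) :
    boundary V n (chainRep G V (n + 1) g c) = chainRep G V n g (boundary V n c) := by
  have : boundary V n ∘ₗ chainRep G V (n + 1) g = chainRep G V n g ∘ₗ boundary V n := by
    refine Submodule.linearMap_qext _ (Finsupp.lhom_ext' fun σ => LinearMap.ext_ring ?_)
    change boundary V n (chainRep G V (n + 1) g (chainOf σ)) =
      chainRep G V n g (boundary V n (chainOf σ))
    rw [chainRep_chainOf, boundary_chainOf, boundary_chainOf, map_sum]
    refine Finset.sum_congr rfl fun i _ => ?_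
    have hf : face i (g • σ) = g • face i σ := by ext k; rfl
    rw [map_smul, chainRep_chainOf, hf]
  exact LinearMap.congr_fun this c

/-- The group `Bₙ` of boundaries. -/
abbrev boundaries : Submodule ℤ (Chain V n) := LinearMap.range (boundary V n)

/-- The action of `G` on `Cₙ / Bₙ`. -/
def quotientRep : Representation ℤ G (Chain V n ⧸ boundaries V n) :=
  (chainRep G V n).quotient (boundaries V n) fun g => by
    rintro _ ⟨c, rfl⟩
    exact ⟨chainRep G V (n + 1) g c, boundary_equivariant G V n g c⟩

/-- The degree-`n` coefficient group `Uₙ = (Cₙ / Bₙ)_G`, the coinvariants of `Cₙ / Bₙ`. -/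
abbrev CoefficientGroup : Type _ := (quotientRep G V n).Coinvariants

variable {V n}

/-- The class in `Uₙ` of an ordered simplex. -/
def coefficientClass (σ : OrderedSimplex V n) : CoefficientGroup G V n :=
  Representation.Coinvariants.mk (quotientRep G V n) ((boundaries V n).mkQ (chainOf σ))

end Coefficients

/-! ### The Witt group of symmetric bilinear forms -/

section Witt

variable (K : Type u) [Field K]

/-- A finite-dimensional vector space over `K` with a non-degenerate symmetric bilinear form. -/
structure BilinSpace where
  /-- the underlying vector space -/
  carrier : Type u
  [addCommGroup : AddCommGroup carrier]
  [module : Module K carrier]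
  [finite : Module.Finite K carrier]
  /-- the bilinear form -/
  form : LinearMap.BilinForm K carrier
  isSymm : form.IsSymm
  nondegenerate : form.Nondegenerate

attribute [instance] BilinSpace.addCommGroup BilinSpace.module BilinSpace.finite

variable {K}

lemma nondegenerate_of_symm {V : Type*} [AddCommGroup V] [Module K V]
    {B : LinearMap.BilinForm K V} (hs : B.IsSymm) (h : ∀ x, (∀ y, B x y = 0) → x = 0) :
    B.Nondegenerate :=
  ⟨h, fun y hy => h y fun x => (hs.eq y x).trans (hy x)⟩

namespace BilinSpace

/-- Two spaces are isometric if there is a linear isomorphism preserving the forms. -/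
def Isometric (M N : BilinSpace K) : Prop :=
  ∃ f : M.carrier ≃ₗ[K] N.carrier, ∀ x y, N.form (f x) (f y) = M.form x y

lemma Isometric.refl (M : BilinSpace K) : Isometric M M :=
  ⟨LinearEquiv.refl K _, fun _ _ => rfl⟩

lemma Isometric.symm {M N : BilinSpace K} : Isometric M N → Isometric N M := by
  rintro ⟨f, hf⟩
  exact ⟨f.symm, fun x y => by rw [← hf]; simp⟩

lemma Isometric.trans {M N P : BilinSpace K} :
    Isometric M N → Isometric N P → Isometric M P := by
  rintro ⟨f, hf⟩ ⟨g, hg⟩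
  exact ⟨f.trans g, fun x y => by simp [hf, hg]⟩

variable (K) in
/-- Isometry as an equivalence relation. -/
instance isometrySetoid : Setoid (BilinSpace K) where
  r := Isometric
  iseqv := ⟨Isometric.refl, Isometric.symm, Isometric.trans⟩

/-- The form `((x, y), (x', y')) ↦ B x x' + B' y y'` on the direct sum. -/
def sumForm (M N : BilinSpace K) : LinearMap.BilinForm K (M.carrier × N.carrier) :=
  M.form.compl₁₂ (LinearMap.fst K _ _) (LinearMap.fst K _ _) +
    N.form.compl₁₂ (LinearMap.snd K _ _) (LinearMap.snd K _ _)

lemma sumForm_isSymm (M N : BilinSpace K) : (sumForm M N).IsSymm :=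
  ⟨fun x y => congrArg₂ (· + ·) (M.isSymm.eq x.1 y.1) (N.isSymm.eq x.2 y.2)⟩

/-- The orthogonal direct sum. -/
def sum (M N : BilinSpace K) : BilinSpace K where
  carrier := M.carrier × N.carrier
  form := sumForm M N
  isSymm := sumForm_isSymm M N
  nondegenerate := nondegenerate_of_symm (sumForm_isSymm M N) fun x hx => Prod.ext
    (M.nondegenerate.1 _ fun y => by simpa [sumForm] using hx (y, 0))
    (N.nondegenerate.1 _ fun y => by simpa [sumForm] using hx (0, y))

@[simp] lemma sum_form (M N : BilinSpace K) (x y : M.carrier × N.carrier) :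
    (sum M N).form x y = M.form x.1 y.1 + N.form x.2 y.2 := rfl

variable (K) in
/-- The zero space. -/
def zero : BilinSpace K where
  carrier := PUnit
  form := 0
  isSymm := ⟨fun _ _ => rfl⟩
  nondegenerate := ⟨fun _ _ => rfl, fun _ _ => rfl⟩

lemma isSymm_smul_mul (a : K) :
    LinearMap.BilinForm.IsSymm (a • LinearMap.mul K K : LinearMap.BilinForm K K) :=
  ⟨fun x y => congrArg (a * ·) (mul_comm x y)⟩

/-- The one-dimensional space `⟨a⟩`, with form `(x, y) ↦ a x y`, for `a ≠ 0`. -/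
def line (a : Kˣ) : BilinSpace K where
  carrier := K
  form := (a : K) • LinearMap.mul K K
  isSymm := isSymm_smul_mul (a : K)
  nondegenerate := nondegenerate_of_symm (isSymm_smul_mul (a : K)) fun x hx => by
    simpa using hx 1

@[simp] lemma line_form (a : Kˣ) (x y : K) : (line a).form x y = a * (x * y) := rfl

variable (K) in
/-- The hyperbolic plane: the form on `K²` with matrix `(0 1; 1 0)`. -/
def hyperbolicPlane : BilinSpace K :=
  have hs : (Matrix.toBilin' !![(0 : K), 1; 1, 0]).IsSymm :=
    ⟨fun x y => by simp [Matrix.toBilin'_apply]; ring⟩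
  { carrier := Fin 2 → K
    form := Matrix.toBilin' !![(0 : K), 1; 1, 0]
    isSymm := hs
    nondegenerate := nondegenerate_of_symm hs fun x hx => by
      have h0 := hx ![1, 0]
      have h1 := hx ![0, 1]
      simp [Matrix.toBilin'_apply] at h0 h1
      ext i
      fin_cases i
      · exact h1
      · exact h0 }

/-- The form on the tensor product with `(x ⊗ y, x' ⊗ y') ↦ B x x' * B' y y'`. -/
def tensorForm (M N : BilinSpace K) : LinearMap.BilinForm K (M.carrier ⊗[K] N.carrier) :=
  LinearMap.BilinForm.tmul M.form N.form

lemma tensorForm_isSymm (M N : BilinSpace K) : (tensorForm M N).IsSymm :=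
  LinearMap.BilinForm.isSymm_iff.2 <|
    (LinearMap.BilinForm.isSymm_iff.1 M.isSymm).tmul (LinearMap.BilinForm.isSymm_iff.1 N.isSymm)

lemma tensorForm_eq (M N : BilinSpace K) :
    (tensorForm M N : M.carrier ⊗[K] N.carrier →ₗ[K] Module.Dual K (M.carrier ⊗[K] N.carrier)) =
      ((TensorProduct.congr (M.form.toDual M.nondegenerate)
        (N.form.toDual N.nondegenerate)).trans
        (TensorProduct.dualDistribEquiv K M.carrier N.carrier)).toLinearMap := by
  ext x y x' y'
  simp [tensorForm, LinearMap.BilinForm.toDual_def, mul_comm]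

/-- The tensor product. -/
def tensor (M N : BilinSpace K) : BilinSpace K where
  carrier := M.carrier ⊗[K] N.carrier
  form := tensorForm M N
  isSymm := tensorForm_isSymm M N
  nondegenerate := nondegenerate_of_symm (tensorForm_isSymm M N) fun z hz => by
    have hz' : (tensorForm M N : M.carrier ⊗[K] N.carrier →ₗ[K]
        Module.Dual K (M.carrier ⊗[K] N.carrier)) z = 0 := LinearMap.ext hz
    rw [tensorForm_eq] at hz'
    simpa only [LinearEquiv.coe_coe, LinearEquiv.map_eq_zero_iff] using hz'

lemma tensor_form_tmul (M N : BilinSpace K) (x x' : M.carrier) (y y' : N.carrier) :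
    (tensor M N).form (x ⊗ₜ[K] y) (x' ⊗ₜ[K] y') = M.form x x' * N.form y y' :=
  mul_comm _ _

lemma Isometric.sum_congr {M M' N N' : BilinSpace K} :
    Isometric M M' → Isometric N N' → Isometric (sum M N) (sum M' N') := by
  rintro ⟨f, hf⟩ ⟨g, hg⟩
  exact ⟨f.prodCongr g, fun x y => congrArg₂ (· + ·) (hf x.1 y.1) (hg x.2 y.2)⟩

end BilinSpace

variable (K)

/-- Isometry classes of non-degenerate symmetric bilinear forms over `K`. -/
def IsometryClass : Type (u + 1) := Quotient (BilinSpace.isometrySetoid K)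

variable {K}

/-- The isometry class of a form. -/
def isometryClass (M : BilinSpace K) : IsometryClass K := Quotient.mk _ M

/-- Addition of isometry classes is induced by the orthogonal direct sum. -/
instance : Add (IsometryClass K) :=
  ⟨Quotient.map₂ BilinSpace.sum fun _ _ h _ _ h' => h.sum_congr h'⟩

/-- The class of the zero space. -/
instance : Zero (IsometryClass K) := ⟨isometryClass (BilinSpace.zero K)⟩

/-- Isometry classes form a commutative monoid under orthogonal direct sum. -/
instance : AddCommMonoid (IsometryClass K) where
  add_assoc := by
    rintro ⟨a⟩ ⟨b⟩ ⟨c⟩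
    exact Quotient.sound ⟨LinearEquiv.prodAssoc K _ _ _, fun x y => (add_assoc _ _ _).symm⟩
  zero_add := by
    rintro ⟨a⟩
    exact Quotient.sound ⟨(LinearEquiv.uniqueProd (M₂ := PUnit.{u + 1}) : _ ≃ₗ[K] a.carrier), fun x y => (zero_add _).symm⟩
  add_zero := by
    rintro ⟨a⟩
    exact Quotient.sound ⟨(LinearEquiv.prodUnique (M₂ := PUnit.{u + 1}) : _ ≃ₗ[K] a.carrier), fun x y => (add_zero _).symm⟩
  add_comm := by
    rintro ⟨a⟩ ⟨b⟩
    exact Quotient.sound ⟨LinearEquiv.prodComm K _ _, fun x y => add_comm _ _⟩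
  nsmul := nsmulRec

lemma isometryClass_add (M N : BilinSpace K) :
    isometryClass M + isometryClass N = isometryClass (M.sum N) := rfl

variable (K)

/-- The additive group of the Witt–Grothendieck ring. -/
abbrev WittGrothendieckGroup : Type (u + 1) := Algebra.GrothendieckAddGroup (IsometryClass K)

/-- The additive group of the ideal of the Witt–Grothendieck ring generated by the class of the
hyperbolic plane. Multiplication is the tensor product, and every element of the
Witt–Grothendieck ring is a difference of classes of forms, so this is the subgroup generated by
the products of classes of forms with the hyperbolic plane. -/
def hyperbolicIdeal : AddSubgroup (WittGrothendieckGroup K) :=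
  AddSubgroup.closure (Set.range fun M : BilinSpace K =>
    Algebra.GrothendieckAddGroup.of (isometryClass (M.tensor (BilinSpace.hyperbolicPlane K))))

/-- The Witt group `W(K)`. -/
abbrev WittGroup : Type (u + 1) := WittGrothendieckGroup K ⧸ hyperbolicIdeal K

variable {K}

/-- The Witt class of a form. -/
def wittClass (M : BilinSpace K) : WittGroup K :=
  QuotientAddGroup.mk (Algebra.GrothendieckAddGroup.of (isometryClass M))

end Witt

/-! ### Square classes and the relations between symbols -/

section Symbols

variable (K : Type u) [Field K]

/-- The group of square classes `Kˣ / (Kˣ)²`. -/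
abbrev SquareClass : Type u := Kˣ ⧸ Subgroup.square Kˣ

variable {K}

/-- The generator `[a]` of the free abelian group on the square classes. -/
def symbol (a : Kˣ) : SquareClass K →₀ ℤ := Finsupp.single (QuotientGroup.mk a) 1

variable (K)

/-- The elements `[a] + [b] - [a + b] - [ab(a + b)]`, for non-zero `a`, `b` with `a + b ≠ 0`. -/
def wittRelators : Set (SquareClass K →₀ ℤ) :=
  {x | ∃ a b c : Kˣ, (c : K) = a + b ∧
    x = symbol a + symbol b - symbol c - symbol (a * b * c)}

/-- The elements `[-a] + [a]`, for non-zero `a`. -/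
def signRelators : Set (SquareClass K →₀ ℤ) :=
  {x | ∃ a : Kˣ, x = symbol (-a) + symbol a}

/-- The group `PSL(2, K)`. -/
abbrev PSL2 : Type u := Matrix.ProjectiveSpecialLinearGroup (Fin 2) K

/-- The projective line over `K`. -/
abbrev P1 : Type u := ℙ K (Fin 2 → K)

variable {K}

/-- The determinant of the matrix with columns `u`, `v`. -/
def det2 (u v : Fin 2 → K) : K := Matrix.det !![u 0, v 0; u 1, v 1]

end Symbols

end SimplexWitt

end

open SimplexWitt

noncomputable section

/-! Both groups are quotients of the free abelian group on square classes, and the proof shows that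
the two kernels are generated by the same elements.

On the simplicial side, `SL(2)` preserves determinants, and rescaling representatives changes
`det(x,y) det(y,z) det(z,x)` by a square. Conversely, equal square classes allow one to solve for
the matrix carrying one triple to the other (`exists_SL2_of_tripleDet_eq`), so orbits of triples are
exactly square classes. A quadruple of points has six determinants subject to the Plücker relation.
After multiplication by suitable squares this relation says `c = a + b` for the symbols of three of
the faces, and the fourth face then has symbol `ab(a + b)` (`range_boundary_eq_wittRelators`).
Permuting a triple multiplies its symbol by the sign. Dividing ordered chains by orbits, boundaries
and alternation gives the presentation in `ker_symbolToCoefficient`.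

On the Witt side, the same two families have to present `W(K)`, in characteristic 2 as well, where
Witt cancellation fails and forms need not be diagonalizable. Stable diagonalization
(`exists_add_diagClass`) is enough for generation and also turns stable isometry into isometry of
diagonal forms. The core is `listSymbol_eq_of_listSpan_eq`: two orthogonal bases of one space have
the same sum of symbols. Because `K` is infinite, some `w` has anisotropic projections onto the
spans of all nonempty initial segments of both bases. Each basis can then be rotated, one plane at a
time, into one starting with `w`, and each rotation costs one Witt relation. The remaining vectors
span the orthogonal complement of `w`, and induction applies. The hyperbolic ideal gives the sign
relations, since `⟨a⟩ ⊗ H ≅ H` and `H = ⟨a⟩ + ⟨-a⟩` in the Grothendieck group. -/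

namespace SimplexWitt

/-! ### Functions that are polynomial along lines -/

section LinePoly

variable {K M : Type*} [Field K] [AddCommGroup M] [Module K M]

/-- A function whose restriction to every line is polynomial. -/
def IsLinePoly (g : M → K) : Prop :=
  ∀ a b : M, ∃ p : Polynomial K, ∀ t : K, g (a + t • b) = p.eval t

lemma IsLinePoly.const (c : K) : IsLinePoly fun _ : M => c :=
  fun _ _ => ⟨Polynomial.C c, fun _ => by simp⟩

lemma IsLinePoly.mul {g h : M → K} (hg : IsLinePoly g) (hh : IsLinePoly h) :
    IsLinePoly fun w => g w * h w := fun a b => by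
  obtain ⟨p, hp⟩ := hg a b
  obtain ⟨r, hr⟩ := hh a b
  exact ⟨p * r, fun t => by simp [hp, hr]⟩

lemma isLinePoly_quadratic (B : LinearMap.BilinForm K M) (P : M →ₗ[K] M) :
    IsLinePoly fun w => B (P w) (P w) := fun a b =>
  ⟨Polynomial.C (B (P a) (P a)) + Polynomial.C (B (P a) (P b) + B (P b) (P a)) * Polynomial.X +
    Polynomial.C (B (P b) (P b)) * Polynomial.X ^ 2, fun t => by simp; ring⟩

/-- On the line through `a` and `b` both functions are non-zero polynomials: one does not vanish at
parameter 0, the other not at parameter 1. Their product has a non-root because the field is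
infinite. This is the general-position argument that picks one vector suited to two bases. -/
lemma IsLinePoly.exists_mul_ne_zero [Infinite K] {g h : M → K} (hg : IsLinePoly g)
    (hh : IsLinePoly h) {S : Submodule K M} {a b : M} (ha : a ∈ S) (hb : b ∈ S) (hga : g a ≠ 0)
    (hhb : h b ≠ 0) : ∃ w ∈ S, g w ≠ 0 ∧ h w ≠ 0 := by
  obtain ⟨p, hp⟩ := hg a (b - a)
  obtain ⟨r, hr⟩ := hh a (b - a)
  have hp0 : p ≠ 0 := by
    rintro rfl
    have := hp 0
    simp_all
  have hr0 : r ≠ 0 := by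
    rintro rfl
    have := hr 1
    simp_all
  have hpr : p * r ≠ 0 := mul_ne_zero hp0 hr0
  obtain ⟨t, ht⟩ : ∃ t, (p * r).eval t ≠ 0 := by
    by_contra! H
    exact hpr (Polynomial.funext fun t => by simpa using H t)
  rw [Polynomial.eval_mul, ← hp, ← hr] at ht
  exact ⟨_, S.add_mem ha (S.smul_mem t (S.sub_mem hb ha)), left_ne_zero_of_mul ht,
    right_ne_zero_of_mul ht⟩

end LinePoly

/-! ### Lists of orthogonal anisotropic vectors -/

section OrthoList

variable {K M A : Type*} [Field K] [AddCommGroup M] [Module K M] [AddCommGroup A]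

/-- The list consists of pairwise orthogonal anisotropic vectors. -/
def OrthoList (B : LinearMap.BilinForm K M) : List M → Prop
  | [] => True
  | e :: L => B e e ≠ 0 ∧ (∀ x ∈ L, B e x = 0) ∧ OrthoList B L

/-- The span of the entries of a list. -/
def listSpan (K : Type*) {M : Type*} [Field K] [AddCommGroup M] [Module K M] :
    List M → Submodule K M
  | [] => ⊥
  | e :: L => Submodule.span K {e} ⊔ listSpan K L

lemma mem_listSpan_of_mem {x : M} : ∀ {L : List M}, x ∈ L → x ∈ listSpan K L
  | e :: L, h => by
    rcases List.mem_cons.1 h with rfl | h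
    · exact Submodule.mem_sup_left (Submodule.mem_span_singleton_self _)
    · exact Submodule.mem_sup_right (mem_listSpan_of_mem h)

lemma listSpan_le {S : Submodule K M} : ∀ {L : List M}, (∀ x ∈ L, x ∈ S) → listSpan K L ≤ S
  | [], _ => bot_le
  | e :: L, h => sup_le ((Submodule.span_singleton_le_iff_mem _ _).2 (h e (by simp)))
      (listSpan_le fun x hx => h x (by simp [hx]))

lemma orthogonal_listSpan {B : LinearMap.BilinForm K M} {v : M} {L : List M}
    (h : ∀ x ∈ L, B v x = 0) {x : M} (hx : x ∈ listSpan K L) : B v x = 0 :=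
  listSpan_le (S := LinearMap.ker (B v)) h hx

/-- The successive projections `P + ∑ B(·, e) / B(e, e) • e` of a vector, for `e` running
through the initial segments of a list, are all anisotropic. -/
def partialProduct (B : LinearMap.BilinForm K M) : (M →ₗ[K] M) → List M → M → K
  | _, [] => fun _ => 1
  | P, e :: L => fun w =>
      B ((P + ((B e e)⁻¹ • B e).smulRight e) w) ((P + ((B e e)⁻¹ • B e).smulRight e) w) *
        partialProduct B (P + ((B e e)⁻¹ • B e).smulRight e) L w

/-- The orthogonal projection onto the span of a list of orthogonal anisotropic vectors. -/
def listProj (B : LinearMap.BilinForm K M) : List M → M →ₗ[K] M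
  | [] => 0
  | e :: L => ((B e e)⁻¹ • B e).smulRight e + listProj B L

lemma isLinePoly_partialProduct (B : LinearMap.BilinForm K M) :
    ∀ (L : List M) (P : M →ₗ[K] M), IsLinePoly (partialProduct B P L)
  | [], _ => IsLinePoly.const 1
  | _ :: L, _ => (isLinePoly_quadratic B _).mul (isLinePoly_partialProduct B L _)

lemma listProj_eq_zero {B : LinearMap.BilinForm K M} (hB : B.IsSymm) {w : M} :
    ∀ {L : List M}, (∀ x ∈ L, B w x = 0) → listProj B L w = 0
  | [], _ => rfl
  | e :: L, h => by
    have h1 : B e w = 0 := (hB.eq w e).symm.trans (h e (by simp))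
    have h2 := listProj_eq_zero hB fun x hx => h x (List.mem_cons_of_mem e hx)
    simp [listProj, h1, h2]

lemma listProj_of_mem {B : LinearMap.BilinForm K M} (hB : B.IsSymm) {w : M} :
    ∀ {L : List M}, OrthoList B L → w ∈ listSpan K L → listProj B L w = w
  | [], _, hw => by
    rw [listSpan, Submodule.mem_bot] at hw
    simp [hw]
  | e :: L, ⟨h0, h1, h2⟩, hw => by
    obtain ⟨x, hx, y, hy, rfl⟩ := Submodule.mem_sup.1 hw
    obtain ⟨c, rfl⟩ := Submodule.mem_span_singleton.1 hx
    have hy' : B e y = 0 := orthogonal_listSpan h1 hy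
    simp [listProj, listProj_eq_zero hB h1, listProj_of_mem hB h2 hy, hy', h0, mul_comm c]

/-- A vector fixed by `P` and orthogonal to the rest of the list is not moved by the later
projections, so every factor is `B v v`. For the first vector of an orthogonal list this shows that
the partial product is not identically zero. -/
lemma partialProduct_ne_zero {B : LinearMap.BilinForm K M} {v : M} (hv : B v v ≠ 0)
    (hB : B.IsSymm) : ∀ {L : List M} {P : M →ₗ[K] M}, P v = v → (∀ x ∈ L, B v x = 0) →
      partialProduct B P L v ≠ 0
  | [], _, _, _ => one_ne_zero
  | e :: L, P, hP, h => by
    have h1 : B e v = 0 := (hB.eq v e).symm.trans (h e (by simp))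
    have h2 : (P + ((B e e)⁻¹ • B e).smulRight e) v = v := by simp [hP, h1]
    have := partialProduct_ne_zero hv hB h2 fun x hx => h x (List.mem_cons_of_mem e hx)
    simp only [partialProduct, h2]
    exact mul_ne_zero hv this

/-- The function `cls` on non-zero scalars is invariant under squares and satisfies the relation
`[a] + [b] = [a + b] + [ab(a + b)]`. -/
structure IsWittSymbol (cls : K → A) : Prop where
  mul_sq : ∀ a s : K, s ≠ 0 → cls (a * s ^ 2) = cls a
  add : ∀ a b : K, a ≠ 0 → b ≠ 0 → a + b ≠ 0 → cls a + cls b = cls (a + b) + cls (a * b * (a + b))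

/-- The sum of the symbols of the values of a form on a list. -/
def listSymbol (cls : K → A) (B : LinearMap.BilinForm K M) (L : List M) : A :=
  (L.map fun x => cls (B x x)).sum

/-- Here `P w` stands for the projection of `w` to the part of the basis already treated. One step
replaces the pair `P w`, `e` by the next projection `P' w = P w + x e` and a vector `u` orthogonal
to it in the same plane. Recursion on the list goes on with `P' w`, leaving `u` aside. The
hypothesis on `partialProduct` says precisely that no projection becomes isotropic on the way. -/
lemma exists_orthoList_cons {cls : K → A} (hcls : IsWittSymbol cls) {B : LinearMap.BilinForm K M}
    (hB : B.IsSymm) (w : M) : ∀ (L : List M) (P : M →ₗ[K] M), OrthoList B (P w :: L) →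
      partialProduct B P L w ≠ 0 → ∃ L' : List M, L'.length = L.length ∧
        OrthoList B ((P w + listProj B L w) :: L') ∧
        listSpan K ((P w + listProj B L w) :: L') = listSpan K (P w :: L) ∧
        listSymbol cls B ((P w + listProj B L w) :: L') = listSymbol cls B (P w :: L)
  | [], P, h, _ => ⟨[], by simpa [listProj] using h⟩
  | e :: L, P, ⟨h0, h1, h2, h3, h4⟩, hp => by
    set P' := P + ((B e e)⁻¹ • B e).smulRight e with hP'
    set v := P w with hv
    set x := (B e e)⁻¹ * B e w with hx
    have hv' : P' w = v + x • e := by simp [hP', ← hv, hx]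
    have hve : B v e = 0 := h1 e (by simp)
    have hev : B e v = 0 := (hB.eq v e).symm.trans hve
    have hq : B (P' w) (P' w) = B v v + x ^ 2 * B e e := by
      rw [hv']; simp [hve, hev]; ring
    simp only [partialProduct, ← hP'] at hp
    have hq0 := left_ne_zero_of_mul hp
    have horth : ∀ y ∈ L, B (P' w) y = 0 := fun y hy => by
      rw [hv']; simp [h1 y (by simp [hy]), h3 y hy]
    obtain ⟨L', hl, ho, hs, hc⟩ := exists_orthoList_cons hcls hB w L P' ⟨hq0, horth, h4⟩
      (right_ne_zero_of_mul hp)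
    -- The orthogonal of `v + x e` in the plane of `v` and `e`, with denominators cleared.
    set u := (B e e * x) • v - B v v • e with hu
    have huu : B u u = B e e * B v v * B (P' w) (P' w) := by
      rw [hq, hu]; simp [hve, hev]; ring
    have hproj : v + listProj B (e :: L) w = P' w + listProj B L w := by
      rw [hv']; simp [listProj, hx, add_assoc]
    have hu' : ∀ y ∈ P' w :: L, B u y = 0 := by
      intro y hy
      rcases List.mem_cons.1 hy with rfl | hy
      · rw [hv', hu]; simp [hve, hev]; ring
      · rw [hu]; simp [h1 y (by simp [hy]), h3 y hy]
    have hu'' : ∀ {y}, y ∈ listSpan K ((P' w + listProj B L w) :: L') → B u y = 0 := fun hy =>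
      orthogonal_listSpan hu' (hs ▸ hy)
    have hspan : Submodule.span K {P' w} ⊔ Submodule.span K {u} =
        Submodule.span K {v} ⊔ Submodule.span K {e} := by
      apply le_antisymm
      · refine sup_le ((Submodule.span_singleton_le_iff_mem _ _).2 ?_)
          ((Submodule.span_singleton_le_iff_mem _ _).2 ?_)
        · rw [hv']
          exact Submodule.add_mem_sup (Submodule.mem_span_singleton_self _)
            (Submodule.smul_mem _ _ (Submodule.mem_span_singleton_self _))
        · rw [hu]
          exact Submodule.sub_mem _ (Submodule.mem_sup_left
            (Submodule.smul_mem _ _ (Submodule.mem_span_singleton_self _)))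
            (Submodule.mem_sup_right
            (Submodule.smul_mem _ _ (Submodule.mem_span_singleton_self _)))
      · have e1 : v = (B (P' w) (P' w))⁻¹ • (B v v • P' w + x • u) := by
          rw [eq_inv_smul_iff₀ hq0, hq, hv', hu]; module
        have e2 : e = (B (P' w) (P' w))⁻¹ • ((B e e * x) • P' w - u) := by
          rw [eq_inv_smul_iff₀ hq0, hq, hv', hu]; module
        have m1 : P' w ∈ Submodule.span K {P' w} ⊔ Submodule.span K {u} :=
          Submodule.mem_sup_left (Submodule.mem_span_singleton_self _)
        have m2 : u ∈ Submodule.span K {P' w} ⊔ Submodule.span K {u} :=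
          Submodule.mem_sup_right (Submodule.mem_span_singleton_self _)
        refine sup_le ((Submodule.span_singleton_le_iff_mem _ _).2 ?_)
          ((Submodule.span_singleton_le_iff_mem _ _).2 ?_)
        · rw [e1]
          exact Submodule.smul_mem _ _ (Submodule.add_mem _ (Submodule.smul_mem _ _ m1)
            (Submodule.smul_mem _ _ m2))
        · rw [e2]
          exact Submodule.smul_mem _ _ (Submodule.sub_mem _ (Submodule.smul_mem _ _ m1) m2)
    -- For `x ≠ 0` this is the Witt relation with `a = B v v` and `b = x² B e e`: then `a + b` is
    -- the value at `P' w`, and `ab(a + b)` is `x²` times the value at `u`. For `x = 0` the vectors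
    -- are only swapped and rescaled.
    have hsym : cls (B (P' w) (P' w)) + cls (B u u) = cls (B v v) + cls (B e e) := by
      rw [huu]
      by_cases hx0 : x = 0
      · rw [hq, hx0]
        have : B e e * B v v * (B v v + 0 ^ 2 * B e e) = B e e * (B v v) ^ 2 := by ring
        rw [this, hcls.mul_sq _ _ h0]
        simp
      · rw [← hcls.mul_sq (B e e) x hx0, ← hcls.mul_sq (B e e * _ * _) x hx0,
          hcls.add (B v v) (B e e * x ^ 2) h0 (mul_ne_zero h2 (pow_ne_zero _ hx0))
            (by rwa [hq, mul_comm] at hq0)]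
        rw [hq]
        congr 2 <;> ring
    refine ⟨u :: L', by simp [hl], ?_, ?_, ?_⟩
    · rw [hproj]
      obtain ⟨o1, o2, o3⟩ := ho
      refine ⟨o1, ?_, ?_, ?_, o3⟩
      · intro y hy
        rcases List.mem_cons.1 hy with rfl | hy
        · rw [← hB.eq]
          exact hu'' (mem_listSpan_of_mem (by simp))
        · exact o2 y hy
      · rw [huu]
        exact mul_ne_zero (mul_ne_zero h2 h0) hq0
      · exact fun y hy => hu'' (mem_listSpan_of_mem (by simp [hy]))
    · rw [hproj]
      simp only [listSpan] at hs ⊢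
      rw [sup_left_comm, hs, ← sup_assoc, ← sup_assoc, ← hspan, sup_comm (Submodule.span K {u})]
    · rw [hproj]
      simp only [listSymbol, List.map_cons, List.sum_cons] at hc ⊢
      rw [add_left_comm, hc, ← add_assoc, ← add_assoc, ← hsym, add_comm (cls (B u u))]

/-- The vector `w` can be made the first entry of an orthogonal basis without changing the sum of
the symbols, if all its successive projections are anisotropic. -/
lemma exists_orthoList_of_partialProduct {cls : K → A} (hcls : IsWittSymbol cls)
    {B : LinearMap.BilinForm K M} (hB : B.IsSymm) {w e : M} {L : List M}
    (hL : OrthoList B (e :: L)) (hw : w ∈ listSpan K (e :: L))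
    (hp : partialProduct B 0 (e :: L) w ≠ 0) : ∃ L' : List M, L'.length = L.length ∧
      OrthoList B (w :: L') ∧ listSpan K (w :: L') = listSpan K (e :: L) ∧
        listSymbol cls B (w :: L') = listSymbol cls B (e :: L) := by
  -- The recursion starts at the projection of `w` to the line of `e`. This is a non-zero multiple
  -- of `e`, so replacing `e` by it changes neither the span nor the symbol.
  set P : M →ₗ[K] M := 0 + ((B e e)⁻¹ • B e).smulRight e with hP
  set x := (B e e)⁻¹ * B e w with hx
  have hPw : P w = x • e := by simp [hP, hx]
  simp only [partialProduct, ← hP] at hp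
  have hp0 := left_ne_zero_of_mul hp
  have hx0 : x ≠ 0 := by
    rintro h
    rw [hPw, h] at hp0
    simp at hp0
  obtain ⟨h0, h1, h2⟩ := hL
  obtain ⟨L', hl, ho, hs, hc⟩ := exists_orthoList_cons hcls hB w L P
    ⟨hp0, fun y hy => by simp [hPw, h1 y hy], h2⟩ (right_ne_zero_of_mul hp)
  have hproj : P w + listProj B L w = w := by
    have := listProj_of_mem hB (L := e :: L) ⟨h0, h1, h2⟩ hw
    simpa [listProj, hP] using this
  rw [hproj] at ho hs hc
  refine ⟨L', hl, ho, ?_, ?_⟩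
  · rw [hs, listSpan, listSpan, hPw, Submodule.span_singleton_smul_eq (IsUnit.mk0 _ hx0)]
  · rw [hc]
    simp only [listSymbol, List.map_cons, List.sum_cons, hPw]
    rw [← hcls.mul_sq (B e e) x hx0]
    congr 2
    simp; ring

/-- Both tails span the orthogonal complement of `w` in the common span. The induction on bases
therefore needs no cancellation theorem. -/
lemma listSpan_le_of_cons {B : LinearMap.BilinForm K M} {w : M} {L L' : List M}
    (h : OrthoList B (w :: L)) (h' : OrthoList B (w :: L'))
    (hs : listSpan K (w :: L) = listSpan K (w :: L')) : listSpan K L ≤ listSpan K L' := by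
  intro x hx
  have hx' : x ∈ listSpan K (w :: L') := hs ▸ Submodule.mem_sup_right hx
  obtain ⟨y, hy, z, hz, rfl⟩ := Submodule.mem_sup.1 hx'
  obtain ⟨c, rfl⟩ := Submodule.mem_span_singleton.1 hy
  have e1 := orthogonal_listSpan h.2.1 hx
  have e2 := orthogonal_listSpan h'.2.1 hz
  simp [e2, h.1] at e1
  simpa [e1] using hz

/-- Orthogonal bases of the same space have the same sum of symbols. -/
theorem listSymbol_eq_of_listSpan_eq [Infinite K] {cls : K → A} (hcls : IsWittSymbol cls)
    {B : LinearMap.BilinForm K M} (hB : B.IsSymm) : ∀ (n : ℕ) (L L' : List M), L.length = n →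
      OrthoList B L → OrthoList B L' → listSpan K L = listSpan K L' →
        listSymbol cls B L = listSymbol cls B L' := by
  have hnil : ∀ (f : M) (L : List M), OrthoList B (f :: L) → listSpan K (f :: L) ≠ ⊥ := by
    intro f L h hs
    have : f ∈ listSpan K (f :: L) := mem_listSpan_of_mem (by simp)
    rw [hs, Submodule.mem_bot] at this
    exact h.1 (by simp [this])
  intro n
  induction n with
  | zero =>
    intro L L' hl h h' hs
    rw [List.length_eq_zero_iff] at hl
    subst hl
    cases L' with
    | nil => rfl
    | cons f L' => exact absurd hs.symm (hnil f L' h')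
  | succ n ih =>
    intro L L' hl h h' hs
    cases L with
    | nil => simp at hl
    | cons e L =>
    cases L' with
    | nil => exact absurd hs (hnil e L h)
    | cons f L' =>
    have key : ∀ {e : M} {L : List M}, OrthoList B (e :: L) →
        partialProduct B 0 (e :: L) e ≠ 0 := by
      rintro e L ⟨h0, h1, h2⟩
      have he : (0 + ((B e e)⁻¹ • B e).smulRight e : M →ₗ[K] M) e = e := by simp [h0]
      simp only [partialProduct, he]
      exact mul_ne_zero h0 (partialProduct_ne_zero h0 hB he h1)
    -- A single `w` that can be made the first vector of both bases; `e` and `f` witness that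
    -- neither condition is vacuous.
    obtain ⟨w, hw, hw1, hw2⟩ := (isLinePoly_partialProduct B (e :: L) 0).exists_mul_ne_zero
      (isLinePoly_partialProduct B (f :: L') 0) (S := listSpan K (e :: L))
      (mem_listSpan_of_mem (by simp)) (hs ▸ mem_listSpan_of_mem (by simp)) (key h) (key h')
    obtain ⟨L1, l1, o1, s1, c1⟩ := exists_orthoList_of_partialProduct hcls hB h hw hw1
    obtain ⟨L2, l2, o2, s2, c2⟩ := exists_orthoList_of_partialProduct hcls hB h' (hs ▸ hw) hw2
    have hs' : listSpan K (w :: L1) = listSpan K (w :: L2) := by rw [s1, s2, hs]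
    have := ih L1 L2 (by simpa [l1] using hl) o1.2.2 o2.2.2
      (le_antisymm (listSpan_le_of_cons o1 o2 hs') (listSpan_le_of_cons o2 o1 hs'.symm))
    rw [← c1, ← c2]
    simp only [listSymbol, List.map_cons, List.sum_cons] at this ⊢
    rw [this]

end OrthoList

/-! ### Isometries and orthogonal splittings -/

section Split

variable {K : Type u} [Field K]

namespace BilinSpace

/-- A form-preserving linear map between spaces of the same dimension is an isometry. -/
lemma isometric_of_linearMap {M N : BilinSpace K} (f : M.carrier →ₗ[K] N.carrier)
    (hf : ∀ x y, N.form (f x) (f y) = M.form x y)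
    (hd : Module.finrank K M.carrier = Module.finrank K N.carrier) : Isometric M N := by
  have hinj : Function.Injective f := by
    rw [← LinearMap.ker_eq_bot, LinearMap.ker_eq_bot']
    intro x hx
    refine M.nondegenerate.1 x fun y => ?_
    rw [← hf, hx]
    simp
  refine ⟨LinearMap.linearEquivOfInjective f hinj hd, fun x y => ?_⟩
  simpa using hf x y

/-- The orthogonal complement of an anisotropic vector. -/
def perp (M : BilinSpace K) (v : M.carrier) (hv : M.form v v ≠ 0) : BilinSpace K where
  carrier := LinearMap.ker (M.form v)
  form := M.form.restrict _
  isSymm := ⟨fun x y => M.isSymm.eq x y⟩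
  nondegenerate := nondegenerate_of_symm ⟨fun x y => M.isSymm.eq x y⟩ fun x hx => by
    refine Subtype.ext (M.nondegenerate.1 _ fun y => ?_)
    have hxv : M.form x v = 0 := (M.isSymm.eq _ _).symm.trans x.2
    -- Test against the component of `y` orthogonal to `v`; the removed multiple of `v` does not
    -- pair with `x`.
    have := hx ⟨y - ((M.form v v)⁻¹ * M.form v y) • v, by
      rw [LinearMap.mem_ker]; simp; field_simp; ring⟩
    simpa [hxv] using this

lemma finrank_perp (M : BilinSpace K) (v : M.carrier) (hv : M.form v v ≠ 0) :
    Module.finrank K (M.perp v hv).carrier + 1 = Module.finrank K M.carrier :=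
  Module.Dual.finrank_ker_add_one_of_ne_zero (f := M.form v) fun h => hv (by rw [h]; rfl)

lemma isometric_line_sum_perp (M : BilinSpace K) (v : M.carrier) (hv : M.form v v ≠ 0) :
    Isometric ((line (Units.mk0 _ hv)).sum (M.perp v hv)) M := by
  refine isometric_of_linearMap
    ((LinearMap.toSpanSingleton K M.carrier v).coprod (Submodule.subtype _)) ?_ ?_
  · rintro ⟨(s : K), x⟩ ⟨(t : K), y⟩
    have hx : M.form (Subtype.val x) v = 0 := (M.isSymm.eq _ _).symm.trans x.2
    have hy : M.form v (Subtype.val y) = 0 := y.2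
    change M.form (s • v + Subtype.val x) (t • v + Subtype.val y) =
      M.form v v * (s * t) + M.form (Subtype.val x) (Subtype.val y)
    simp only [map_add, LinearMap.add_apply, map_smul, LinearMap.smul_apply, smul_eq_mul, hx, hy]
    ring
  · have := M.finrank_perp v hv
    change Module.finrank K (K × (M.perp v hv).carrier) = _
    rw [Module.finrank_prod, Module.finrank_self]
    omega

lemma isometryClass_eq {M N : BilinSpace K} : isometryClass M = isometryClass N ↔ Isometric M N :=
  ⟨Quotient.exact, fun h => Quotient.sound h⟩

lemma isometric_line_mul_sq (a s : Kˣ) : Isometric (line (a * s ^ 2)) (line a) :=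
  isometric_of_linearMap (LinearMap.mulLeft K (s : K)) (fun (x : K) (y : K) => by
    change (a : K) * ((s * x) * (s * y)) = (a * s ^ 2 : Kˣ) * (x * y)
    push_cast
    ring) rfl

/-- In `⟨a⟩ ⊕ ⟨b⟩` the vectors `(1, 1)` and `(b, -a)` are orthogonal, with values `a + b` and `ab² +
ba² = ab(a + b)`. -/
lemma isometric_sum_line (a b c : Kˣ) (hc : (c : K) = a + b) :
    Isometric ((line c).sum (line (a * b * c))) ((line a).sum (line b)) :=
  isometric_of_linearMap
    (((LinearMap.id : K →ₗ[K] K).coprod (LinearMap.mulLeft K (b : K))).prod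
      ((LinearMap.id : K →ₗ[K] K).coprod (-LinearMap.mulLeft K (a : K))))
    (by
      rintro ⟨(x : K), (y : K)⟩ ⟨(x' : K), (y' : K)⟩
      change (a : K) * ((x + b * y) * (x' + b * y')) + b * ((x + -(a * y)) * (x' + -(a * y'))) =
        c * (x * x') + (a * b * c : Kˣ) * (y * y')
      push_cast
      rw [hc]
      ring) rfl

lemma hyperbolicPlane_form (x y : Fin 2 → K) :
    (hyperbolicPlane K).form x y = x 0 * y 1 + x 1 * y 0 := by
  change Matrix.toBilin' !![(0 : K), 1; 1, 0] x y = _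
  simp [Matrix.toBilin'_apply]

/-- The extra `⟨a⟩` cannot be dropped in characteristic 2: there the hyperbolic plane is alternating
and `⟨a⟩ ⊕ ⟨-a⟩` is not. The three chosen vectors of `H ⊕ ⟨a⟩` are pairwise orthogonal with values
`a`, `-a`, `a`. -/
lemma isometric_line_neg_line (a : Kˣ) :
    Isometric ((line a).sum ((line (-a)).sum (line a)))
      ((hyperbolicPlane K).sum (line a)) := by
  refine isometric_of_linearMap (M := (line a).sum ((line (-a)).sum (line a)))
    (N := (hyperbolicPlane K).sum (line a))
    (((LinearMap.toSpanSingleton K ((Fin 2 → K) × K) (![1, 0], 1)).coprod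
      ((LinearMap.toSpanSingleton K ((Fin 2 → K) × K) (![1, -(a : K)], 1)).coprod
      (LinearMap.toSpanSingleton K ((Fin 2 → K) × K) (![0, -(a : K)], 1))))) ?_ ?_
  · rintro ⟨(x : K), (y : K), (z : K)⟩ ⟨(x' : K), (y' : K), (z' : K)⟩
    change (hyperbolicPlane K).form
        (x • ![1, 0] + (y • ![1, -(a : K)] + z • ![0, -(a : K)]) : Fin 2 → K)
        (x' • ![1, 0] + (y' • ![1, -(a : K)] + z' • ![0, -(a : K)]) : Fin 2 → K) +
        a * ((x * 1 + (y * 1 + z * 1)) * (x' * 1 + (y' * 1 + z' * 1))) =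
      a * (x * x') + ((-a : Kˣ) * (y * y') + a * (z * z'))
    rw [hyperbolicPlane_form]
    simp
    ring
  · change Module.finrank K (K × K × K) = Module.finrank K ((Fin 2 → K) × K)
    simp

/-- Scaling the hyperbolic form by `a` is undone by multiplying the second coordinate by `a⁻¹`. -/
lemma isometric_line_tensor_hyperbolicPlane (a : Kˣ) :
    Isometric (hyperbolicPlane K) ((line a).tensor (hyperbolicPlane K)) := by
  let g : (Fin 2 → K) →ₗ[K] (Fin 2 → K) :=
    LinearMap.pi ![LinearMap.proj 0, (a⁻¹ : K) • LinearMap.proj 1]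
  refine isometric_of_linearMap (N := (line a).tensor (hyperbolicPlane K))
    (TensorProduct.mk K K (Fin 2 → K) 1 ∘ₗ g) ?_ ?_
  · intro (x : Fin 2 → K) (y : Fin 2 → K)
    have h1 : ((line a).tensor (hyperbolicPlane K)).form ((1 : K) ⊗ₜ[K] g x) ((1 : K) ⊗ₜ[K] g y) =
        a * ((1 : K) * 1) * (hyperbolicPlane K).form (g x) (g y) :=
      tensor_form_tmul (line a) (hyperbolicPlane K) (1 : K) (1 : K) (g x) (g y)
    refine h1.trans ?_
    rw [hyperbolicPlane_form, hyperbolicPlane_form]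
    simp [g]
    field_simp
  · change Module.finrank K (Fin 2 → K) = Module.finrank K (K ⊗[K] (Fin 2 → K))
    simp

lemma bilinForm_tensor_ext {V W : Type*} [AddCommGroup V] [Module K V] [AddCommGroup W]
    [Module K W] {B B' : LinearMap.BilinForm K (V ⊗[K] W)}
    (h : ∀ a b c d, B (a ⊗ₜ b) (c ⊗ₜ d) = B' (a ⊗ₜ b) (c ⊗ₜ d)) : B = B' :=
  TensorProduct.ext' fun a b => TensorProduct.ext' fun c d => h a b c d

lemma Isometric.tensor_right {M N : BilinSpace K} (P : BilinSpace K) :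
    Isometric M N → Isometric (M.tensor P) (N.tensor P) := by
  rintro ⟨f, hf⟩
  let g : M.carrier ⊗[K] P.carrier ≃ₗ[K] N.carrier ⊗[K] P.carrier :=
    TensorProduct.congr f (LinearEquiv.refl K _)
  have h : (tensorForm N P).compl₁₂ g.toLinearMap g.toLinearMap = tensorForm M P :=
    bilinForm_tensor_ext fun a b c d => by
      refine (tensor_form_tmul N P (f a) (f c) b d).trans (Eq.trans ?_
        (tensor_form_tmul M P a c b d).symm)
      rw [hf]
  exact ⟨g, fun x y => LinearMap.congr_fun₂ h x y⟩

lemma isometric_sum_tensor (M N P : BilinSpace K) :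
    Isometric ((M.sum N).tensor P) ((M.tensor P).sum (N.tensor P)) := by
  let g : (M.carrier × N.carrier) ⊗[K] P.carrier ≃ₗ[K]
    (M.carrier ⊗[K] P.carrier) × (N.carrier ⊗[K] P.carrier) :=
    TensorProduct.prodLeft K K M.carrier N.carrier P.carrier
  have h : (sumForm (M.tensor P) (N.tensor P)).compl₁₂ g.toLinearMap g.toLinearMap =
      tensorForm (M.sum N) P :=
    bilinForm_tensor_ext fun a b c d => by
      refine Eq.trans (congrArg₂ (· + ·) (tensor_form_tmul M P a.1 c.1 b d)
        (tensor_form_tmul N P a.2 c.2 b d)) (Eq.trans ?_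
        (tensor_form_tmul (M.sum N) P a c b d).symm)
      rw [sum_form, add_mul]
  exact ⟨g, fun x y => LinearMap.congr_fun₂ h x y⟩

end BilinSpace

end Split

/-! ### Diagonal forms -/

section Diagonal

open BilinSpace

variable {K : Type u} [Field K]

/-- The isometry class of a diagonal form. -/
def diagClass (l : List Kˣ) : IsometryClass K :=
  (l.map fun a => isometryClass (line a)).sum

lemma diagClass_append (l m : List Kˣ) : diagClass (l ++ m) = diagClass l + diagClass m := by
  simp [diagClass]

lemma diagClass_cons (a : Kˣ) (l : List Kˣ) :
    diagClass (a :: l) = isometryClass (line a) + diagClass l := by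
  simp [diagClass]

/-- Every form becomes diagonal after adding a diagonal form. -/
lemma exists_add_diagClass (n : ℕ) : ∀ M : BilinSpace K, Module.finrank K M.carrier = n →
    ∃ D E : List Kˣ, isometryClass M + diagClass D = diagClass E := by
  induction n using Nat.strong_induction_on with
  | _ n ih =>
  intro M hM
  by_cases h : ∃ v, M.form v v ≠ 0
  · obtain ⟨v, hv⟩ := h
    have hd := M.finrank_perp v hv
    obtain ⟨D, E, hDE⟩ := ih _ (by omega) (M.perp v hv) rfl
    refine ⟨D, Units.mk0 _ hv :: E, ?_⟩
    rw [← isometryClass_eq.2 (M.isometric_line_sum_perp v hv), diagClass_cons, ← hDE,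
      ← isometryClass_add, add_assoc]
  push Not at h
  by_cases hx : ∃ x : M.carrier, x ≠ 0
  · obtain ⟨x, hx⟩ := hx
    obtain ⟨y, hy⟩ : ∃ y, M.form x y ≠ 0 := by
      by_contra! H
      exact hx (M.nondegenerate.1 x H)
    -- All values `B(v, v)` vanish, so nothing splits off directly. After adding `⟨1⟩`, the vector
    -- `(x, 1)` has value 1, and `(y, -B(x, y))` is orthogonal to it with value `B(x, y)²`.
    -- Splitting off both leaves a space of dimension one less than that of `M`.
    set N := M.sum (line 1) with hN
    have hv : N.form (x, (1 : K)) (x, (1 : K)) ≠ 0 := by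
      change M.form x x + (1 : Kˣ) * ((1 : K) * 1) ≠ 0
      simp [h]
    set P := N.perp (x, (1 : K)) hv with hP
    let w : P.carrier := ⟨(y, (-M.form x y : K)), by
      change M.form x y + (1 : Kˣ) * ((1 : K) * (-M.form x y)) = 0
      simp⟩
    have hw : P.form w w ≠ 0 := by
      change M.form y y + (1 : Kˣ) * (-M.form x y * -M.form x y) ≠ 0
      simp [h, hy]
    have h1 := N.finrank_perp (x, (1 : K)) hv
    rw [← hP] at h1
    have h2 := P.finrank_perp w hw
    have h3 : Module.finrank K N.carrier = Module.finrank K M.carrier + 1 := by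
      change Module.finrank K (M.carrier × K) = _
      simp
    obtain ⟨D, E, hDE⟩ := ih _ (by omega) (P.perp w hw) rfl
    refine ⟨1 :: D, Units.mk0 _ hv :: Units.mk0 _ hw :: E, ?_⟩
    have e1 := isometryClass_eq.2 (N.isometric_line_sum_perp _ hv)
    have e2 := isometryClass_eq.2 (P.isometric_line_sum_perp w hw)
    rw [← isometryClass_add] at e1 e2
    rw [diagClass_cons, diagClass_cons, diagClass_cons, ← hDE, ← add_assoc, isometryClass_add,
      ← e1, ← e2]
    simp only [add_assoc]
  · push Not at hx
    refine ⟨[], [], ?_⟩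
    have : isometryClass M = 0 := by
      have : Subsingleton M.carrier := ⟨fun a b => by rw [hx a, hx b]⟩
      exact isometryClass_eq.2 (isometric_of_linearMap (N := zero K) 0
        (fun a b => by rw [hx a]; simp) (by
          change _ = Module.finrank K PUnit.{u + 1}
          rw [Module.finrank_zero_of_subsingleton, Module.finrank_zero_of_subsingleton]))
    simp [diagClass, this]

lemma listSpan_map {M N : Type*} [AddCommGroup M] [Module K M] [AddCommGroup N] [Module K N]
    (f : M →ₗ[K] N) : ∀ L : List M, listSpan K (L.map f) = (listSpan K L).map f
  | [] => by simp [listSpan]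
  | e :: L => by
    simp [listSpan, Submodule.map_sup, Submodule.map_span, listSpan_map f L]

lemma OrthoList.map {M N : Type*} [AddCommGroup M] [Module K M] [AddCommGroup N] [Module K N]
    {B : LinearMap.BilinForm K M} {B' : LinearMap.BilinForm K N} {f : M →ₗ[K] N}
    (hf : ∀ x y, B' (f x) (f y) = B x y) : ∀ {L : List M}, OrthoList B L → OrthoList B' (L.map f)
  | [], _ => trivial
  | e :: L, ⟨h0, h1, h2⟩ => by
    refine ⟨by rwa [hf], ?_, h2.map hf⟩
    intro y hy
    obtain ⟨x, hx, rfl⟩ := List.mem_map.1 hy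
    rw [hf, h1 x hx]

lemma listSymbol_map {A : Type*} [AddCommGroup A] {M N : Type*} [AddCommGroup M] [Module K M]
    [AddCommGroup N] [Module K N] (cls : K → A) {B : LinearMap.BilinForm K M}
    {B' : LinearMap.BilinForm K N} {f : M →ₗ[K] N} (hf : ∀ x y, B' (f x) (f y) = B x y)
    (L : List M) : listSymbol cls B' (L.map f) = listSymbol cls B L := by
  simp [listSymbol, Function.comp_def, hf]

/-- A diagonal form has an orthogonal basis with the given values. -/
lemma exists_orthoList_of_diagClass {A : Type*} [AddCommGroup A] (cls : K → A) :
    ∀ (l : List Kˣ) (M : BilinSpace K), isometryClass M = diagClass l →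
      ∃ L : List M.carrier, OrthoList M.form L ∧ listSpan K L = ⊤ ∧
        listSymbol cls M.form L = (l.map fun a : Kˣ => cls (a : K)).sum
  | [], M, h => by
    obtain ⟨f, -⟩ := isometryClass_eq.1 (h : isometryClass M = isometryClass (zero K))
    have : Subsingleton M.carrier := f.toEquiv.subsingleton_congr.2 (inferInstanceAs
      (Subsingleton PUnit))
    exact ⟨[], trivial, Subsingleton.elim _ _, rfl⟩
  | a :: l, M, h => by
    obtain ⟨N, hN⟩ := Quotient.exists_rep (diagClass l)
    rw [diagClass_cons, ← hN] at h
    obtain ⟨f, hf⟩ := (isometryClass_eq.1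
      (h : isometryClass M = isometryClass ((line a).sum N))).symm
    obtain ⟨L, h1, h2, h3⟩ := exists_orthoList_of_diagClass cls l N hN
    let g : K × N.carrier →ₗ[K] M.carrier := f.toLinearMap
    have hg : ∀ x y : K × N.carrier, M.form (g x) (g y) = a * (x.1 * y.1) + N.form x.2 y.2 :=
      fun x y => hf x y
    have hr : ∀ x y, M.form ((g ∘ₗ LinearMap.inr K K N.carrier) x)
        ((g ∘ₗ LinearMap.inr K K N.carrier) y) = N.form x y := fun x y => by
      simp [hg]
    refine ⟨g (1, 0) :: L.map (g ∘ₗ LinearMap.inr K K N.carrier), ⟨by simp [hg], ?_, h1.map hr⟩,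
      ?_, ?_⟩
    · intro y hy
      obtain ⟨x, -, rfl⟩ := List.mem_map.1 hy
      simp [hg]
    · rw [listSpan, listSpan_map, h2, eq_top_iff]
      rintro x -
      obtain ⟨⟨(s : K), n⟩, rfl⟩ := f.surjective x
      have : f (s, n) = s • g (1, 0) + (g ∘ₗ LinearMap.inr K K N.carrier) n := by
        rw [LinearMap.comp_apply, ← map_smul, ← map_add]
        change g (s, n) = _
        simp
      rw [this]
      exact Submodule.add_mem_sup (Submodule.smul_mem _ _ (Submodule.mem_span_singleton_self _))
        (Submodule.mem_map_of_mem trivial)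
    · have := listSymbol_map cls hr L
      simp only [listSymbol, List.map_cons, List.sum_cons] at this h3 ⊢
      rw [this, h3]
      simp [hg]

/-- Isometric diagonal forms have the same sum of symbols. -/
theorem sum_symbol_eq_of_diagClass_eq [Infinite K] {A : Type*} [AddCommGroup A] {cls : K → A}
    (hcls : IsWittSymbol cls) {l m : List Kˣ} (h : diagClass l = diagClass m) :
    (l.map fun a : Kˣ => cls (a : K)).sum = (m.map fun a : Kˣ => cls (a : K)).sum := by
  obtain ⟨M, hM⟩ := Quotient.exists_rep (diagClass l)
  obtain ⟨L, h1, h2, h3⟩ := exists_orthoList_of_diagClass cls l M hM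
  obtain ⟨L', h1', h2', h3'⟩ := exists_orthoList_of_diagClass cls m M (hM.trans h)
  rw [← h3, ← h3', listSymbol_eq_of_listSpan_eq hcls M.isSymm _ L L' rfl h1 h1' (h2.trans h2'.symm)]

end Diagonal

/-! ### Presentations of the Witt–Grothendieck group and the Witt group -/

section Presentation

open BilinSpace Algebra

variable {K : Type u} [Field K]

lemma symbol_mul_sq (a s : Kˣ) : symbol (a * s ^ 2) = symbol a := by
  unfold symbol
  congr 1
  exact (QuotientGroup.eq.2 (by
    rw [Subgroup.mem_square, inv_mul_cancel_left]
    exact ⟨s, sq s⟩)).symm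

/-- The isometry class of the one-dimensional form attached to a square class. -/
def lineClass : SquareClass K → IsometryClass K :=
  Quotient.lift (fun a => isometryClass (line a)) fun a b h => by
    obtain ⟨s, hs⟩ := Subgroup.mem_square.1 (QuotientGroup.leftRel_apply.1 h)
    have : b = a * s ^ 2 := by rw [sq, ← hs, mul_inv_cancel_left]
    rw [this]
    exact (isometryClass_eq.2 (isometric_line_mul_sq a s)).symm

variable (K) in
/-- The homomorphism from the free abelian group on the square classes to the Witt–Grothendieck
group. -/
def toGrothendieck : (SquareClass K →₀ ℤ) →+ WittGrothendieckGroup K :=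
  Finsupp.liftAddHom fun c => zmultiplesHom _ (GrothendieckAddGroup.of (lineClass c))

lemma toGrothendieck_symbol (a : Kˣ) :
    toGrothendieck K (symbol a) = GrothendieckAddGroup.of (isometryClass (line a)) := by
  simp [toGrothendieck, symbol]
  rfl

lemma toGrothendieck_sum (l : List Kˣ) :
    toGrothendieck K (l.map symbol).sum = GrothendieckAddGroup.of (diagClass l) := by
  simp only [diagClass, map_list_sum, List.map_map]
  congr 2
  ext a
  exact toGrothendieck_symbol a

/-- Every element of the Witt–Grothendieck group is a difference of two isometry classes. -/
lemma exists_of_sub_of (x : WittGrothendieckGroup K) : ∃ M N : BilinSpace K,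
    x = GrothendieckAddGroup.of (isometryClass M) - GrothendieckAddGroup.of (isometryClass N) := by
  obtain ⟨⟨m, n⟩, h⟩ := (AddLocalization.addMonoidOf (⊤ : AddSubmonoid (IsometryClass K))).surj x
  obtain ⟨M, rfl⟩ := Quotient.exists_rep m
  obtain ⟨N, hN⟩ := Quotient.exists_rep (n : IsometryClass K)
  refine ⟨M, N, eq_sub_of_add_eq ?_⟩
  rw [isometryClass, hN]
  exact h

lemma of_eq_of_iff {m n : IsometryClass K} :
    GrothendieckAddGroup.of m = GrothendieckAddGroup.of n ↔ ∃ c, c + m = c + n := by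
  refine ((AddLocalization.addMonoidOf (⊤ : AddSubmonoid (IsometryClass K))).eq_iff_exists).trans ?_
  exact ⟨fun ⟨c, h⟩ => ⟨c, h⟩, fun ⟨c, h⟩ => ⟨⟨c, trivial⟩, h⟩⟩

lemma toGrothendieck_surjective : Function.Surjective (toGrothendieck K) := by
  have key : ∀ M : BilinSpace K,
      GrothendieckAddGroup.of (isometryClass M) ∈ (toGrothendieck K).range := fun M => by
    obtain ⟨D, E, h⟩ := exists_add_diagClass _ M rfl
    refine ⟨(E.map symbol).sum - (D.map symbol).sum, ?_⟩
    rw [map_sub, toGrothendieck_sum, toGrothendieck_sum, ← h, map_add, add_sub_cancel_right]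
  intro x
  obtain ⟨M, N, rfl⟩ := exists_of_sub_of x
  exact AddSubgroup.sub_mem _ (key M) (key N)

lemma exists_list_sub_list (x : SquareClass K →₀ ℤ) :
    ∃ l m : List Kˣ, x = (l.map symbol).sum - (m.map symbol).sum := by
  induction x using Finsupp.induction_linear with
  | zero => exact ⟨[], [], by simp⟩
  | add x y hx hy =>
    obtain ⟨l, m, rfl⟩ := hx
    obtain ⟨l', m', rfl⟩ := hy
    exact ⟨l ++ l', m ++ m', by simp; abel⟩
  | single c z =>
    obtain ⟨a, rfl⟩ := QuotientGroup.mk_surjective c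
    have : (Finsupp.single (QuotientGroup.mk a : SquareClass K) z : SquareClass K →₀ ℤ) =
        z • symbol a := by simp [symbol]
    rw [this]
    obtain ⟨n, rfl | rfl⟩ := z.eq_nat_or_neg
    · exact ⟨List.replicate n a, [], by simp⟩
    · exact ⟨[], List.replicate n a, by simp⟩

variable (K) in
/-- The image of a scalar in the quotient of the free abelian group on the square classes by the
Witt relators. -/
def scalarSymbol (a : K) :
    (SquareClass K →₀ ℤ) ⧸ AddSubgroup.closure (wittRelators K) :=
  -- The value at 0 is immaterial: the additive law excludes it, and invariance under squares is
  -- trivial there.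
  open Classical in if h : a = 0 then 0 else QuotientAddGroup.mk (symbol (Units.mk0 a h))

lemma scalarSymbol_unit (a : Kˣ) :
    scalarSymbol K (a : K) = QuotientAddGroup.mk (symbol a) := by
  simp [scalarSymbol]

lemma isWittSymbol_scalarSymbol : IsWittSymbol (scalarSymbol K) where
  mul_sq a s hs := by
    by_cases ha : a = 0
    · simp [ha]
    · lift a to Kˣ using isUnit_iff_ne_zero.2 ha
      lift s to Kˣ using isUnit_iff_ne_zero.2 hs
      rw [← Units.val_pow_eq_pow_val, ← Units.val_mul, scalarSymbol_unit, scalarSymbol_unit,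
        symbol_mul_sq]
  add a b ha hb hab := by
    obtain ⟨c, hc⟩ : ∃ c : Kˣ, (c : K) = a + b := ⟨Units.mk0 _ hab, rfl⟩
    lift a to Kˣ using isUnit_iff_ne_zero.2 ha
    lift b to Kˣ using isUnit_iff_ne_zero.2 hb
    rw [← hc, ← Units.val_mul, ← Units.val_mul]
    simp only [scalarSymbol_unit]
    rw [← sub_eq_zero, ← QuotientAddGroup.mk_add, ← QuotientAddGroup.mk_add,
      ← QuotientAddGroup.mk_sub, QuotientAddGroup.eq_zero_iff]
    exact AddSubgroup.subset_closure ⟨a, b, c, hc, by abel⟩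

/-- The Witt–Grothendieck group is presented by the one-dimensional forms and the Witt relators. -/
theorem ker_toGrothendieck [Infinite K] :
    (toGrothendieck K).ker = AddSubgroup.closure (wittRelators K) := by
  apply le_antisymm
  · intro x hx
    obtain ⟨l, m, rfl⟩ := exists_list_sub_list x
    rw [AddMonoidHom.mem_ker, map_sub, sub_eq_zero, toGrothendieck_sum, toGrothendieck_sum,
      of_eq_of_iff] at hx
    obtain ⟨c, hc⟩ := hx
    obtain ⟨M, rfl⟩ := Quotient.exists_rep c
    -- Equality in the Grothendieck group is isometry after adding some form `M`. Adding `D` as well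
    -- makes the added summand diagonal, so two diagonal forms become isometric.
    obtain ⟨D, E, h⟩ := exists_add_diagClass _ M rfl
    have h2 : diagClass (l ++ E) = diagClass (m ++ E) := by
      have e : ∀ n : List Kˣ, diagClass (n ++ E) = (isometryClass M + diagClass n) + diagClass D :=
        fun n => by rw [diagClass_append, ← h, add_right_comm, add_comm]
      rw [e, e]
      exact congrArg (· + _) hc
    have h3 := sum_symbol_eq_of_diagClass_eq isWittSymbol_scalarSymbol h2
    rw [List.map_append, List.map_append, List.sum_append, List.sum_append, add_left_inj] at h3
    simp only [scalarSymbol_unit] at h3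
    have e : ∀ n : List Kˣ, (n.map fun a : Kˣ => (QuotientAddGroup.mk (symbol a) :
        (SquareClass K →₀ ℤ) ⧸ AddSubgroup.closure (wittRelators K))).sum =
          QuotientAddGroup.mk (n.map symbol).sum := fun n => by
      have := map_list_sum (QuotientAddGroup.mk' (AddSubgroup.closure (wittRelators K)))
        (n.map symbol)
      rw [List.map_map] at this
      exact this.symm
    rw [e, e, ← sub_eq_zero, ← QuotientAddGroup.mk_sub, QuotientAddGroup.eq_zero_iff] at h3
    exact h3
  · rw [AddSubgroup.closure_le]
    rintro _ ⟨a, b, c, hc, rfl⟩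
    change toGrothendieck K _ = 0
    simp only [map_sub, map_add, toGrothendieck_symbol]
    rw [sub_sub, ← map_add, ← map_add, isometryClass_add, isometryClass_add,
      isometryClass_eq.2 (isometric_sum_line a b c hc), sub_self]

variable (K) in
/-- The class of the tensor product with the hyperbolic plane. -/
def tensorHyperbolic : IsometryClass K →+ WittGrothendieckGroup K :=
    { toFun := Quotient.lift
        (fun M : BilinSpace K =>
          GrothendieckAddGroup.of (isometryClass (M.tensor (hyperbolicPlane K))))
        fun _ _ h => congrArg _ (isometryClass_eq.2 (Isometric.tensor_right _ h))
      -- Since `0 ⊕ 0 ≅ 0`, the image of zero equals its own double, hence vanishes in the group.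
      map_zero' := by
        have h := isometryClass_eq.2 (isometric_sum_tensor (zero K) (zero K) (hyperbolicPlane K))
        rw [← isometryClass_add, isometryClass_eq.2 (Isometric.tensor_right _
          (isometryClass_eq.1 (add_zero (isometryClass (zero K)))))] at h
        have h2 := congrArg (GrothendieckAddGroup.of (M := IsometryClass K)) h
        rw [map_add] at h2
        exact left_eq_add.1 h2
      map_add' := by
        rintro ⟨M⟩ ⟨N⟩
        change GrothendieckAddGroup.of (isometryClass ((M.sum N).tensor (hyperbolicPlane K))) =
          GrothendieckAddGroup.of (isometryClass (M.tensor (hyperbolicPlane K))) +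
            GrothendieckAddGroup.of (isometryClass (N.tensor (hyperbolicPlane K)))
        rw [isometryClass_eq.2 (isometric_sum_tensor M N (hyperbolicPlane K)),
          ← isometryClass_add, map_add] }

variable (K) in
/-- Multiplication of the Witt–Grothendieck group by the hyperbolic plane. -/
def mulHyperbolic : WittGrothendieckGroup K →+ WittGrothendieckGroup K :=
  GrothendieckAddGroup.lift (tensorHyperbolic K)

lemma mulHyperbolic_of (M : BilinSpace K) :
    mulHyperbolic K (GrothendieckAddGroup.of (isometryClass M)) =
      GrothendieckAddGroup.of (isometryClass (M.tensor (hyperbolicPlane K))) := 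
  DFunLike.congr_fun (GrothendieckAddGroup.lift.symm_apply_apply (tensorHyperbolic K))
    (isometryClass M)

/-- The spare `⟨a⟩` of `isometric_line_neg_line` cancels in the Grothendieck group, although it need
not cancel for isometry classes. -/
lemma of_hyperbolicPlane (a : Kˣ) :
    GrothendieckAddGroup.of (isometryClass (hyperbolicPlane K)) =
      toGrothendieck K (symbol (-a) + symbol a) := by
  have h := congrArg (GrothendieckAddGroup.of (M := IsometryClass K))
    (isometryClass_eq.2 (isometric_line_neg_line a))
  simp only [← isometryClass_add, map_add] at h
  rw [map_add, toGrothendieck_symbol, toGrothendieck_symbol]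
  rw [add_comm] at h
  exact (add_right_cancel h).symm

/-- The hyperbolic ideal is generated by the images of the sign relators. -/
lemma hyperbolicIdeal_eq :
    hyperbolicIdeal K = (AddSubgroup.closure (signRelators K)).map (toGrothendieck K) := by
  apply le_antisymm
  -- Multiplication by the hyperbolic plane is additive and one-dimensional forms generate, so it
  -- suffices to treat `⟨a⟩ ⊗ H ≅ H`.
  · have key : ∀ x, mulHyperbolic K (toGrothendieck K x) ∈
        (AddSubgroup.closure (signRelators K)).map (toGrothendieck K) := by
      intro x
      obtain ⟨l, m, rfl⟩ := exists_list_sub_list x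
      have e : ∀ n : List Kˣ, mulHyperbolic K (toGrothendieck K (n.map symbol).sum) ∈
          (AddSubgroup.closure (signRelators K)).map (toGrothendieck K) := fun n => by
        rw [map_list_sum, map_list_sum, List.map_map, List.map_map]
        refine AddSubgroup.list_sum_mem _ fun y hy => ?_
        obtain ⟨a, -, rfl⟩ := List.mem_map.1 hy
        simp only [Function.comp_apply, toGrothendieck_symbol, mulHyperbolic_of]
        rw [← isometryClass_eq.2 (isometric_line_tensor_hyperbolicPlane a), of_hyperbolicPlane a]
        exact AddSubgroup.mem_map_of_mem _ (AddSubgroup.subset_closure ⟨a, rfl⟩)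
      rw [map_sub, map_sub]
      exact AddSubgroup.sub_mem _ (e l) (e m)
    rw [hyperbolicIdeal, AddSubgroup.closure_le]
    rintro _ ⟨M, rfl⟩
    obtain ⟨x, hx⟩ := toGrothendieck_surjective (GrothendieckAddGroup.of (isometryClass M))
    have := key x
    rw [hx, mulHyperbolic_of] at this
    exact this
  · rw [AddSubgroup.map_le_iff_le_comap, AddSubgroup.closure_le]
    rintro _ ⟨a, rfl⟩
    change toGrothendieck K _ ∈ hyperbolicIdeal K
    rw [← of_hyperbolicPlane a, isometryClass_eq.2 (isometric_line_tensor_hyperbolicPlane a)]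
    exact AddSubgroup.subset_closure ⟨line a, rfl⟩

variable (K) in
/-- The homomorphism from the free abelian group on the square classes to the Witt group. -/
def toWitt : (SquareClass K →₀ ℤ) →+ WittGroup K :=
  (QuotientAddGroup.mk' (hyperbolicIdeal K)).comp (toGrothendieck K)

lemma toWitt_symbol (a : Kˣ) : toWitt K (symbol a) = wittClass (line a) := by
  rw [toWitt, AddMonoidHom.comp_apply, toGrothendieck_symbol]
  rfl

lemma toWitt_surjective : Function.Surjective (toWitt K) :=
  (QuotientAddGroup.mk'_surjective _).comp toGrothendieck_surjective

/-- The Witt group is presented by the one-dimensional forms, the Witt relators and the sign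
relators. -/
theorem ker_toWitt [Infinite K] :
    (toWitt K).ker = AddSubgroup.closure (wittRelators K ∪ signRelators K) := by
  rw [toWitt, ← AddMonoidHom.comap_ker, QuotientAddGroup.ker_mk', hyperbolicIdeal_eq,
    AddSubgroup.comap_map_eq, ker_toGrothendieck, AddSubgroup.closure_union, sup_comm]

end Presentation

/-! ### Triples of points of the projective line -/

section Triples

variable {K : Type u} [Field K]

lemma det2_eq (u v : Fin 2 → K) : det2 u v = u 0 * v 1 - v 0 * u 1 := by
  simp [det2, Matrix.det_fin_two]

lemma det2_swap (u v : Fin 2 → K) : det2 v u = -det2 u v := by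
  simp only [det2_eq]; ring

lemma det2_smul (a b : K) (u v : Fin 2 → K) : det2 (a • u) (b • v) = a * b * det2 u v := by
  simp only [det2_eq, Pi.smul_apply, smul_eq_mul]; ring

lemma det2_plucker (x y z w : Fin 2 → K) :
    det2 x y * det2 z w + det2 x w * det2 y z = det2 x z * det2 y w := by
  simp only [det2_eq]; ring

lemma det2_ne_zero {u v : Fin 2 → K} (hu : u ≠ 0) (hv : v ≠ 0)
    (h : Projectivization.mk K u hu ≠ Projectivization.mk K v hv) : det2 u v ≠ 0 := by
  intro h0
  rw [det2_eq, sub_eq_zero] at h0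
  refine h ((Projectivization.mk_eq_mk_iff' K u v hu hv).2 ?_)
  by_cases hv0 : v 0 = 0
  · have hv1 : v 1 ≠ 0 := fun h1 => hv (by ext i; fin_cases i <;> assumption)
    refine ⟨u 1 / v 1, ?_⟩
    ext i
    fin_cases i
    · simp [hv0] at h0 ⊢
      tauto
    · simp [hv1]
  · refine ⟨u 0 / v 0, ?_⟩
    ext i
    fin_cases i
    · simp [hv0]
    · simp
      field_simp
      rw [h0, mul_comm]

lemma mk_ne_mk_of_det2_ne_zero {u v : Fin 2 → K} (hu : u ≠ 0) (hv : v ≠ 0) (h : det2 u v ≠ 0) :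
    Projectivization.mk K u hu ≠ Projectivization.mk K v hv := by
  rintro h0
  obtain ⟨a, rfl⟩ := (Projectivization.mk_eq_mk_iff' K u v hu hv).1 h0
  apply h
  simp only [det2_eq, Pi.smul_apply, smul_eq_mul]
  ring

/-- The product `det(x, y) det(y, z) det(z, x)`. -/
def tripleDet (x y z : Fin 2 → K) : K := det2 x y * det2 y z * det2 z x

lemma tripleDet_ne_zero {x y z : Fin 2 → K} (hx : x ≠ 0) (hy : y ≠ 0) (hz : z ≠ 0)
    {σ : OrderedSimplex (P1 K) 2} (h0 : σ 0 = Projectivization.mk K x hx)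
    (h1 : σ 1 = Projectivization.mk K y hy) (h2 : σ 2 = Projectivization.mk K z hz) :
    tripleDet x y z ≠ 0 :=
  mul_ne_zero (mul_ne_zero
    (det2_ne_zero hx hy (by rw [← h0, ← h1]; exact fun h => by simpa using σ.injective h))
    (det2_ne_zero hy hz (by rw [← h1, ← h2]; exact fun h => by simpa using σ.injective h)))
    (det2_ne_zero hz hx (by rw [← h2, ← h0]; exact fun h => by simpa using σ.injective h))

lemma squareClass_eq {a b : Kˣ} {s : K} (h : (b : K) = a * s ^ 2) :
    (QuotientGroup.mk a : SquareClass K) = QuotientGroup.mk b := by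
  have hs : s ≠ 0 := by
    rintro rfl
    simp at h
  refine QuotientGroup.eq.2 (Subgroup.mem_square.2 ⟨Units.mk0 s hs, Units.ext ?_⟩)
  simp [h]
  ring

lemma exists_of_squareClass_eq {a b : Kˣ}
    (h : (QuotientGroup.mk a : SquareClass K) = QuotientGroup.mk b) :
    ∃ s : Kˣ, (b : K) = a * s ^ 2 := by
  obtain ⟨s, hs⟩ := Subgroup.mem_square.1 (QuotientGroup.eq.1 h)
  refine ⟨s, ?_⟩
  rw [← Units.val_pow_eq_pow_val, ← Units.val_mul, sq, ← hs, mul_inv_cancel_left]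

/-- The square class of `det(x, y) det(y, z) det(z, x)` for a triple of points of the projective
line represented by `x`, `y`, `z`. -/
def tripleSymbol (σ : OrderedSimplex (P1 K) 2) : SquareClass K :=
  QuotientGroup.mk (Units.mk0 (tripleDet (σ 0).rep (σ 1).rep (σ 2).rep)
    (tripleDet_ne_zero (σ 0).rep_nonzero (σ 1).rep_nonzero (σ 2).rep_nonzero
      (Projectivization.mk_rep _).symm (Projectivization.mk_rep _).symm
      (Projectivization.mk_rep _).symm))

/-- Each vector occurs in two of the three determinants, so rescaling by `r`, `s`, `t` multiplies
the product by `(rst)²`. -/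
lemma tripleSymbol_eq {σ : OrderedSimplex (P1 K) 2} {x y z : Fin 2 → K} {hx : x ≠ 0} {hy : y ≠ 0}
    {hz : z ≠ 0} {a : Kˣ} (h0 : σ 0 = Projectivization.mk K x hx)
    (h1 : σ 1 = Projectivization.mk K y hy) (h2 : σ 2 = Projectivization.mk K z hz)
    (ha : (a : K) = tripleDet x y z) : tripleSymbol σ = QuotientGroup.mk a := by
  obtain ⟨r, hr⟩ := Projectivization.exists_smul_eq_mk_rep K x hx
  obtain ⟨s, hs⟩ := Projectivization.exists_smul_eq_mk_rep K y hy
  obtain ⟨t, ht⟩ := Projectivization.exists_smul_eq_mk_rep K z hz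
  refine (squareClass_eq (s := ((r * s * t : Kˣ) : K)) ?_).symm
  rw [Units.val_mk0, h0, h1, h2, ← hr, ← hs, ← ht, ha]
  simp only [tripleDet, Units.smul_def, det2_smul]
  push_cast
  ring

/-- The simplex whose vertices are the lines spanned by the given vectors. -/
def simplexOf {n : ℕ} (v : Fin (n + 1) → Fin 2 → K) (hv : ∀ i, v i ≠ 0)
    (h : ∀ i j, i < j → det2 (v i) (v j) ≠ 0) : OrderedSimplex (P1 K) n where
  toFun i := Projectivization.mk K (v i) (hv i)
  inj' i j hij := by
    by_contra hne
    rcases lt_or_gt_of_ne hne with hlt | hlt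
    · exact mk_ne_mk_of_det2_ne_zero _ _ (h i j hlt) hij
    · exact mk_ne_mk_of_det2_ne_zero _ _ (h j i hlt) hij.symm

lemma tripleSymbol_surjective : Function.Surjective (tripleSymbol (K := K)) := by
  intro c
  obtain ⟨a, rfl⟩ := QuotientGroup.mk_surjective c
  have e1 : (![1, 0] : Fin 2 → K) ≠ 0 := fun h => by simpa using congrFun h 0
  have e2 : (![0, 1] : Fin 2 → K) ≠ 0 := fun h => by simpa using congrFun h 1
  have e3 : (![(a : K), 1] : Fin 2 → K) ≠ 0 := fun h => by simpa using congrFun h 1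
  refine ⟨simplexOf (n := 2) ![![1, 0], ![0, 1], ![(a : K), 1]] ?_ ?_, tripleSymbol_eq (hx := e1)
    (hy := e2) (hz := e3) rfl rfl rfl ?_⟩
  · intro i
    fin_cases i
    exacts [e1, e2, e3]
  · intro i j hij
    fin_cases i <;> fin_cases j <;> simp [det2_eq] at hij ⊢
  · simp [tripleDet, det2_eq]

lemma PSL2_smul_mk (g : Matrix.SpecialLinearGroup (Fin 2) K) (v : Fin 2 → K) (hv : v ≠ 0) :
    (QuotientGroup.mk g : PSL2 K) • (Projectivization.mk K v hv : P1 K) =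
      Projectivization.mk K (g • v) ((smul_ne_zero_iff_ne g).2 hv) := rfl

lemma SL2_smul_apply (g : Matrix.SpecialLinearGroup (Fin 2) K) (v : Fin 2 → K) (i : Fin 2) :
    (g • v) i = g.1 i 0 * v 0 + g.1 i 1 * v 1 := by
  rw [Matrix.SpecialLinearGroup.smul_def]
  simp [Matrix.mulVec, dotProduct]

lemma det2_smul_smul (g : Matrix.SpecialLinearGroup (Fin 2) K) (u v : Fin 2 → K) :
    det2 (g • u) (g • v) = det2 u v := by
  have h := g.2
  rw [Matrix.det_fin_two] at h
  simp only [det2_eq, SL2_smul_apply]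
  linear_combination (u 0 * v 1 - v 0 * u 1) * h

lemma tripleSymbol_smul (g : PSL2 K) (σ : OrderedSimplex (P1 K) 2) :
    tripleSymbol (g • σ) = tripleSymbol σ := by
  obtain ⟨g, rfl⟩ := QuotientGroup.mk_surjective g
  have h : ∀ i, ((QuotientGroup.mk g : PSL2 K) • σ) i =
      Projectivization.mk K (g • (σ i).rep) ((smul_ne_zero_iff_ne g).2 (σ i).rep_nonzero) := by
    intro i
    rw [← PSL2_smul_mk _ _ (σ i).rep_nonzero, Projectivization.mk_rep]
    rfl
  refine tripleSymbol_eq (h 0) (h 1) (h 2) ?_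
  simp only [tripleDet, det2_smul_smul, Units.val_mk0]

/-- Two triples of vectors with the same invariant up to squares are related by `SL(2, K)`, up to
rescaling of the vectors. -/
lemma exists_SL2_of_tripleDet_eq {x y z x' y' z' : Fin 2 → K} {m : K}
    (h : tripleDet x y z ≠ 0) (h' : tripleDet x' y' z' ≠ 0)
    (hm : tripleDet x' y' z' = tripleDet x y z * m ^ 2) :
    ∃ (g : Matrix.SpecialLinearGroup (Fin 2) K) (a b c : K),
      g • x = a • x' ∧ g • y = b • y' ∧ g • z = c • z' := by
  have hm0 : m ≠ 0 := by
    rintro rfl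
    simp [hm] at h'
  unfold tripleDet at h h' hm
  set A := det2 x y with hA
  set B := det2 y z with hB
  set C := det2 z x with hC
  set A' := det2 x' y' with hA'
  set B' := det2 y' z' with hB'
  set C' := det2 z' x' with hC'
  have hA0 : A ≠ 0 := fun h0 => h (by simp [h0])
  have hB0 : B ≠ 0 := fun h0 => h (by simp [h0])
  have hC0 : C ≠ 0 := fun h0 => h (by simp [h0])
  -- A matrix of determinant 1 with `gx = ax'`, `gy = by'`, `gz = cz'` forces `abA' = A`, `bcB' =
  -- B`, `caC' = C`. With `A'B'C' = ABCm²` this gives `a² = (B'/(Bm))²`, and cyclically for `b` and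
  -- `c`.
  set a := B' / (B * m) with ha
  set b := C' / (C * m) with hb
  have hab : a * b * A' = A := by
    rw [ha, hb]
    field_simp
    linear_combination hm
  -- The matrix with `gx = ax'` and `gy = by'`, by Cramer's rule; its determinant is `abA'/A`.
  have hg : Matrix.det !![(a * x' 0 * y 1 - b * y' 0 * x 1) / A,
      (b * y' 0 * x 0 - a * x' 0 * y 0) / A;
      (a * x' 1 * y 1 - b * y' 1 * x 1) / A,
      (b * y' 1 * x 0 - a * x' 1 * y 0) / A] = 1 := by
    rw [Matrix.det_fin_two_of]
    field_simp
    have e1 := hA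
    have e2 := hA'
    rw [det2_eq] at e1 e2
    rw [e2] at hab
    rw [e1] at hab ⊢
    linear_combination (x 0 * y 1 - y 0 * x 1) * hab
  set g : Matrix.SpecialLinearGroup (Fin 2) K := ⟨_, hg⟩ with hgdef
  have hgx : g • x = a • x' := by
    have e1 := hA
    rw [det2_eq] at e1
    ext i
    rw [SL2_smul_apply]
    fin_cases i <;> simp [hgdef] <;> field_simp <;> rw [e1] <;> ring
  have hgy : g • y = b • y' := by
    have e1 := hA
    rw [det2_eq] at e1
    ext i
    rw [SL2_smul_apply]
    fin_cases i <;> simp [hgdef] <;> field_simp <;> rw [e1] <;> ring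
  -- The linear relation between three vectors of the plane, through which the images of `x` and `y`
  -- determine that of `z`.
  have key : ∀ u v w : Fin 2 → K, det2 u v • w = -(det2 v w) • u - det2 w u • v := by
    intro u v w
    ext i
    fin_cases i <;> simp [det2_eq] <;> ring
  refine ⟨g, a, b, A' / (A * m), hgx, hgy, ?_⟩
  have hz : z = A⁻¹ • (-B • x - C • y) := by
    rw [hA, hB, hC, ← key, smul_smul, inv_mul_cancel₀ hA0, one_smul]
  have e2 := key x' y' z'
  rw [← hA', ← hB', ← hC'] at e2
  have e3 : (A' / (A * m)) • z' = (A * m)⁻¹ • (-B' • x' - C' • y') := by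
    rw [← e2, smul_smul, div_eq_inv_mul]
  rw [e3, hz, smul_comm g, smul_sub, smul_comm g, smul_comm g, hgx, hgy, ha, hb]
  ext i
  simp
  field_simp

/-- The symbol of a triple of points determines its orbit. -/
theorem tripleSymbol_eq_iff (σ τ : OrderedSimplex (P1 K) 2) :
    tripleSymbol σ = tripleSymbol τ ↔ ∃ g : PSL2 K, g • σ = τ := by
  constructor
  · intro h
    obtain ⟨m, hm⟩ := exists_of_squareClass_eq h
    rw [Units.val_mk0, Units.val_mk0] at hm
    obtain ⟨g, a, b, c, h0, h1, h2⟩ := exists_SL2_of_tripleDet_eq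
      (tripleDet_ne_zero (σ 0).rep_nonzero (σ 1).rep_nonzero (σ 2).rep_nonzero
        (Projectivization.mk_rep _).symm (Projectivization.mk_rep _).symm
        (Projectivization.mk_rep _).symm)
      (tripleDet_ne_zero (τ 0).rep_nonzero (τ 1).rep_nonzero (τ 2).rep_nonzero
        (Projectivization.mk_rep _).symm (Projectivization.mk_rep _).symm
        (Projectivization.mk_rep _).symm) hm
    refine ⟨QuotientGroup.mk g, ?_⟩
    have key : ∀ (i : Fin 3) (r : K), g • (σ i).rep = r • (τ i).rep →
        (QuotientGroup.mk g : PSL2 K) • σ i = τ i := by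
      intro i r hr
      conv_lhs => rw [← Projectivization.mk_rep (σ i)]
      conv_rhs => rw [← Projectivization.mk_rep (τ i)]
      rw [PSL2_smul_mk, Projectivization.mk_eq_mk_iff']
      exact ⟨r, hr.symm⟩
    ext i
    change (QuotientGroup.mk g : PSL2 K) • σ i = τ i
    fin_cases i
    exacts [key 0 a h0, key 1 b h1, key 2 c h2]
  · rintro ⟨g, rfl⟩
    exact (tripleSymbol_smul g σ).symm

/-! ### The boundary and alternation relations in symbols -/

lemma single_tripleSymbol_face (ρ : OrderedSimplex (P1 K) 3) (i : Fin 4) {a : Kˣ}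
    {v : Fin 4 → Fin 2 → K} {hv : ∀ i, v i ≠ 0} (h : ∀ i, ρ i = Projectivization.mk K (v i) (hv i))
    (ha : (a : K) = tripleDet (v (i.succAbove 0)) (v (i.succAbove 1)) (v (i.succAbove 2))) :
    (Finsupp.single (tripleSymbol (face i ρ)) 1 : SquareClass K →₀ ℤ) = symbol a := by
  rw [tripleSymbol_eq (σ := face i ρ) (h _) (h _) (h _) ha]
  rfl

lemma mapDomain_boundary (ρ : OrderedSimplex (P1 K) 3) {d0 d1 d2 d3 : Kˣ}
    {v : Fin 4 → Fin 2 → K} {hv : ∀ i, v i ≠ 0} (h : ∀ i, ρ i = Projectivization.mk K (v i) (hv i))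
    (h0 : (d0 : K) = tripleDet (v 1) (v 2) (v 3)) (h1 : (d1 : K) = tripleDet (v 0) (v 2) (v 3))
    (h2 : (d2 : K) = tripleDet (v 0) (v 1) (v 3)) (h3 : (d3 : K) = tripleDet (v 0) (v 1) (v 2)) :
    Finsupp.mapDomain tripleSymbol (orderedBoundary (P1 K) 2 (Finsupp.single ρ 1)) =
      symbol d0 + symbol d2 - symbol d1 - symbol d3 := by
  have key : Finsupp.mapDomain tripleSymbol (orderedBoundary (P1 K) 2 (Finsupp.single ρ 1)) =
      ∑ i : Fin 4, (-1 : ℤ) ^ (i : ℕ) •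
        (Finsupp.single (tripleSymbol (face i ρ)) 1 : SquareClass K →₀ ℤ) := by
    simp only [orderedBoundary, Finsupp.linearCombination_single, one_smul]
    rw [Finsupp.mapDomain_finsetSum]
    simp [Finsupp.mapDomain_single]
  rw [key, Fin.sum_univ_four, single_tripleSymbol_face ρ 0 h h0, single_tripleSymbol_face ρ 1 h h1,
    single_tripleSymbol_face ρ 2 h h2, single_tripleSymbol_face ρ 3 h h3]
  simp
  abel

lemma symbol_eq {a b : Kˣ} {s : K} (h : (b : K) = a * s ^ 2) : symbol a = symbol b := by
  rw [symbol, symbol, squareClass_eq h]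

/-- The boundaries of the ordered 3-simplices, written in symbols, are the Witt relators. -/
theorem range_boundary_eq_wittRelators :
    (Set.range fun ρ : OrderedSimplex (P1 K) 3 =>
      Finsupp.mapDomain tripleSymbol (orderedBoundary (P1 K) 2 (Finsupp.single ρ 1))) =
        wittRelators K := by
  apply Set.Subset.antisymm
  · rintro _ ⟨ρ, rfl⟩
    have hne : ∀ i j, i ≠ j → det2 (ρ i).rep (ρ j).rep ≠ 0 := fun i j hij =>
      det2_ne_zero (ρ i).rep_nonzero (ρ j).rep_nonzero (by
        rw [Projectivization.mk_rep, Projectivization.mk_rep]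
        exact fun h => hij (ρ.injective h))
    have hd : ∀ i j k, i ≠ j → j ≠ k → k ≠ i →
        tripleDet (ρ i).rep (ρ j).rep (ρ k).rep ≠ 0 := fun i j k h1 h2 h3 =>
      mul_ne_zero (mul_ne_zero (hne i j h1) (hne j k h2)) (hne k i h3)
    have h0 := hd 1 2 3 (by decide) (by decide) (by decide)
    have h1 := hd 0 2 3 (by decide) (by decide) (by decide)
    have h2 := hd 0 1 3 (by decide) (by decide) (by decide)
    have h3 := hd 0 1 2 (by decide) (by decide) (by decide)
    have p03 := hne 0 3 (by decide)
    have p23 := hne 2 3 (by decide)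
    have p13 := hne 1 3 (by decide)
    have hb := mapDomain_boundary ρ (d0 := Units.mk0 _ h0) (d1 := Units.mk0 _ h1)
      (d2 := Units.mk0 _ h2) (d3 := Units.mk0 _ h3) (v := fun i => (ρ i).rep)
      (hv := fun i => (ρ i).rep_nonzero)
      (fun i => (Projectivization.mk_rep _).symm) rfl rfl rfl rfl
    -- Write `pij` for the determinants and `Δ = p03 p13 p23`. The square factors turn the three
    -- faces containing vertex 3 into `-Δ p12 p03`, `-Δ p01 p23` and `-Δ p02 p13`, so `a + b = c` is
    -- the Plücker relation times `-Δ`. The product `abc` is `Δ⁴` times the invariant of the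
    -- remaining face.
    refine ⟨Units.mk0 _ h0 * Units.mk0 _ p03 ^ 2, Units.mk0 _ h2 * Units.mk0 _ p23 ^ 2,
      Units.mk0 _ h1 * Units.mk0 _ p13 ^ 2, ?_, hb.trans ?_⟩
    · have hP := det2_plucker (ρ 0).rep (ρ 1).rep (ρ 2).rep (ρ 3).rep
      push_cast
      simp only [Units.val_mk0, tripleDet]
      rw [det2_swap (ρ 0).rep (ρ 3).rep, det2_swap (ρ 1).rep (ρ 3).rep]
      linear_combination (det2 (ρ 0).rep (ρ 3).rep * det2 (ρ 1).rep (ρ 3).rep *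
        det2 (ρ 2).rep (ρ 3).rep) * hP
    · rw [symbol_mul_sq, symbol_mul_sq, symbol_mul_sq]
      congr 1
      refine symbol_eq (s := (det2 (ρ 0).rep (ρ 3).rep * det2 (ρ 1).rep (ρ 3).rep *
        det2 (ρ 2).rep (ρ 3).rep) ^ 2) ?_
      push_cast
      simp only [Units.val_mk0, tripleDet]
      rw [det2_swap (ρ 0).rep (ρ 3).rep, det2_swap (ρ 1).rep (ρ 3).rep,
        det2_swap (ρ 0).rep (ρ 2).rep]
      ring
  · rintro _ ⟨a, b, c, hc, rfl⟩
    have e : ∀ r : K, (![r, 1] : Fin 2 → K) ≠ 0 := fun r h => by simpa using congrFun h 1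
    have e1 : (![1, 0] : Fin 2 → K) ≠ 0 := fun h => by simpa using congrFun h 0
    have e3 : (![-(a : K) / b, -c / b ^ 2] : Fin 2 → K) ≠ 0 := fun h => by
      simpa using congrFun h 0
    -- The third vector is fixed by `p12 = a / b` and `p23 = 1`, where `c = a + b` enters. The faces
    -- omitting vertices 0, 1, 2, 3 then have invariants `a`, `c/b²`, `b` and `abc/b⁴`.
    have hv : ∀ i, (![![1, 0], ![0, 1], ![-(a : K) / b, -c / b ^ 2], ![(b : K), 1]] :
        Fin 4 → Fin 2 → K) i ≠ 0 := by
      intro i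
      fin_cases i
      exacts [e1, e 0, e3, e _]
    have p01 : det2 ![(1 : K), 0] ![0, 1] = 1 := by simp [det2_eq]
    have p02 : det2 ![(1 : K), 0] ![-(a : K) / b, -c / b ^ 2] = -c / b ^ 2 := by simp [det2_eq]
    have p03 : det2 ![(1 : K), 0] ![(b : K), 1] = 1 := by simp [det2_eq]
    have p12 : det2 ![(0 : K), 1] ![-(a : K) / b, -c / b ^ 2] = a / b := by
      simp [det2_eq, neg_div]
    have p13 : det2 ![(0 : K), 1] ![(b : K), 1] = -b := by simp [det2_eq]
    have p23 : det2 ![-(a : K) / b, -c / b ^ 2] ![(b : K), 1] = 1 := by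
      simp [det2_eq, hc]
      field_simp
      ring
    have hdet : ∀ i j : Fin 4, i < j →
        det2 ((![![1, 0], ![0, 1], ![-(a : K) / b, -c / b ^ 2], ![(b : K), 1]] :
          Fin 4 → Fin 2 → K) i) ((![![1, 0], ![0, 1], ![-(a : K) / b, -c / b ^ 2], ![(b : K), 1]] :
          Fin 4 → Fin 2 → K) j) ≠ 0 := by
      intro i j hij
      fin_cases i <;> fin_cases j <;> first
        | exact absurd hij (by decide)
        | simp [p01, p02, p03, p12, p13, p23]
    refine ⟨simplexOf (n := 3) _ hv hdet, (mapDomain_boundary _ (d0 := a) (d1 := c * (b⁻¹) ^ 2)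
      (d2 := b) (d3 := a * b * c * (b⁻¹ ^ 2) ^ 2) (fun i => rfl) ?_ ?_ ?_ ?_).trans ?_⟩
    · change (a : K) = tripleDet ![(0 : K), 1] ![-(a : K) / b, -c / b ^ 2] ![(b : K), 1]
      rw [tripleDet, det2_swap ![(0 : K), 1] ![(b : K), 1], p12, p13, p23]
      field_simp
    · change ((c * (b⁻¹) ^ 2 : Kˣ) : K) =
        tripleDet ![(1 : K), 0] ![-(a : K) / b, -c / b ^ 2] ![(b : K), 1]
      rw [tripleDet, det2_swap ![(1 : K), 0] ![(b : K), 1], p02, p03, p23]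
      push_cast
      field_simp
    · change (b : K) = tripleDet ![(1 : K), 0] ![0, 1] ![(b : K), 1]
      rw [tripleDet, det2_swap ![(1 : K), 0] ![(b : K), 1], p01, p03, p13]
      ring
    · change ((a * b * c * (b⁻¹ ^ 2) ^ 2 : Kˣ) : K) =
        tripleDet ![(1 : K), 0] ![0, 1] ![-(a : K) / b, -c / b ^ 2]
      rw [tripleDet, det2_swap ![(1 : K), 0] ![-(a : K) / b, -c / b ^ 2], p01, p02, p12]
      push_cast
      field_simp
    · rw [symbol_mul_sq, symbol_mul_sq]

/-- A transposition of two vectors reverses the sign of all three determinants. The six permutations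
are checked one by one. -/
lemma tripleDet_permute (t : Equiv.Perm (Fin 3)) (v : Fin 3 → Fin 2 → K) :
    tripleDet (v (t 0)) (v (t 1)) (v (t 2)) =
      ((Equiv.Perm.sign t : ℤ) : K) * tripleDet (v 0) (v 1) (v 2) := by
  have h : ∀ t : Equiv.Perm (Fin 3), (t 0, t 1, t 2, (Equiv.Perm.sign t : ℤ)) ∈
      ([(0, 1, 2, 1), (1, 2, 0, 1), (2, 0, 1, 1), (1, 0, 2, -1), (0, 2, 1, -1), (2, 1, 0, -1)] :
        List (Fin 3 × Fin 3 × Fin 3 × ℤ)) := by decide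
  have ht := h t
  simp only [List.mem_cons, Prod.mk.injEq, List.not_mem_nil, or_false] at ht
  rcases ht with ⟨h0, h1, h2, h3⟩ | ⟨h0, h1, h2, h3⟩ | ⟨h0, h1, h2, h3⟩ | ⟨h0, h1, h2, h3⟩ |
    ⟨h0, h1, h2, h3⟩ | ⟨h0, h1, h2, h3⟩ <;>
  · rw [h0, h1, h2, h3]
    simp only [tripleDet, det2_swap (v 0) (v 1), det2_swap (v 1) (v 2), det2_swap (v 0) (v 2)]
    push_cast
    ring

lemma mapDomain_alternationRelator (t : Equiv.Perm (Fin 3)) (σ : OrderedSimplex (P1 K) 2) :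
    Finsupp.mapDomain tripleSymbol (alternationRelator t σ) =
      Finsupp.single (tripleSymbol (permute t σ)) 1 -
        (Equiv.Perm.sign t : ℤ) • Finsupp.single (tripleSymbol σ) (1 : ℤ) := by
  have := map_sub (Finsupp.mapDomain.addMonoidHom (M := ℤ) (tripleSymbol (K := K)))
    (Finsupp.single (permute t σ) 1) ((Equiv.Perm.sign t : ℤ) • Finsupp.single σ 1)
  simpa [Finsupp.mapDomain.addMonoidHom, Finsupp.mapDomain_single, alternationRelator] using this

lemma tripleSymbol_permute (t : Equiv.Perm (Fin 3)) {σ : OrderedSimplex (P1 K) 2} {a b : Kˣ}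
    (ha : tripleSymbol σ = QuotientGroup.mk a)
    (hb : (b : K) = ((Equiv.Perm.sign t : ℤ) : K) * a) :
    tripleSymbol (permute t σ) = QuotientGroup.mk b := by
  obtain ⟨s, hs⟩ := exists_of_squareClass_eq ha
  set d : Kˣ := Units.mk0 (tripleDet (σ 0).rep (σ 1).rep (σ 2).rep)
    (tripleDet_ne_zero (σ 0).rep_nonzero (σ 1).rep_nonzero (σ 2).rep_nonzero
      (Projectivization.mk_rep _).symm (Projectivization.mk_rep _).symm
      (Projectivization.mk_rep _).symm) with hd
  have h : ∀ i, permute t σ i = Projectivization.mk K (σ (t i)).rep (σ (t i)).rep_nonzero :=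
    fun i => (Projectivization.mk_rep _).symm
  rw [tripleSymbol_eq (a := b * (s⁻¹) ^ 2) (h 0) (h 1) (h 2)]
  · refine squareClass_eq (s := s) ?_
    push_cast
    field_simp
  · rw [tripleDet_permute t fun i => (σ i).rep]
    push_cast
    rw [hb, hs, Units.val_mk0]
    field_simp

/-- The alternation relators, written in symbols, generate the same group as the sign relators. -/
theorem closure_alternation_eq_closure_signRelators :
    AddSubgroup.closure (Set.range fun p : Equiv.Perm (Fin 3) × OrderedSimplex (P1 K) 2 =>
      Finsupp.mapDomain tripleSymbol (alternationRelator p.1 p.2)) =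
        AddSubgroup.closure (signRelators K) := by
  apply le_antisymm
  · rw [AddSubgroup.closure_le]
    rintro _ ⟨⟨t, σ⟩, rfl⟩
    obtain ⟨a, ha⟩ := QuotientGroup.mk_surjective (tripleSymbol σ)
    simp only [mapDomain_alternationRelator]
    -- Even permutations keep the symbol, so their relator becomes zero; odd ones give `[-a] + [a]`.
    rcases Int.units_eq_one_or (Equiv.Perm.sign t) with h | h
    · rw [tripleSymbol_permute t (b := a) ha.symm (by simp [h]), h, ← ha]
      simp
    · rw [tripleSymbol_permute t (b := -a) ha.symm (by simp [h]), h, ← ha]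
      refine AddSubgroup.subset_closure ⟨a, ?_⟩
      simp [symbol]
  · rw [AddSubgroup.closure_le]
    rintro _ ⟨a, rfl⟩
    obtain ⟨σ, hσ⟩ := tripleSymbol_surjective (QuotientGroup.mk a : SquareClass K)
    refine AddSubgroup.subset_closure ⟨(Equiv.swap 0 1, σ), ?_⟩
    have h : Equiv.Perm.sign (Equiv.swap (0 : Fin 3) 1) = -1 := Equiv.Perm.sign_swap (by decide)
    simp only [mapDomain_alternationRelator]
    rw [tripleSymbol_permute _ (b := -a) hσ (by simp [h]), h, hσ]
    simp [symbol]

end Triples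

/-! ### The presentation of the coefficient group -/

section CoefficientPresentation

variable {G V : Type*} [Group G] [MulAction G V] {n : ℕ}

variable (G V n) in
/-- The class of an ordered chain in the coefficient group. -/
def orderedClass : OrderedChain V n →ₗ[ℤ] CoefficientGroup G V n :=
  Representation.Coinvariants.mk (quotientRep G V n) ∘ₗ (boundaries V n).mkQ ∘ₗ
    (alternation V n).mkQ

lemma orderedClass_surjective : Function.Surjective (orderedClass G V n) :=
  (Representation.Coinvariants.mk_surjective _).comp
    ((Submodule.mkQ_surjective _).comp (Submodule.mkQ_surjective _))

lemma orderedClass_alternationRelator (t : Equiv.Perm (Fin (n + 1))) (σ : OrderedSimplex V n) :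
    orderedClass G V n (alternationRelator t σ) = 0 := by
  have h : (alternation V n).mkQ (alternationRelator t σ) = 0 :=
    (Submodule.Quotient.mk_eq_zero _).2 (Submodule.subset_span ⟨(t, σ), rfl⟩)
  have h' : (boundaries V n).mkQ ((alternation V n).mkQ (alternationRelator t σ)) = 0 := by
    rw [h, map_zero]
  exact (congrArg (Representation.Coinvariants.mk (quotientRep G V n)) h').trans (map_zero _)

lemma orderedClass_boundary (ρ : OrderedSimplex V (n + 1)) :
    orderedClass G V n (orderedBoundary V n (Finsupp.single ρ 1)) = 0 := by
  have h : (boundaries V n).mkQ ((alternation V n).mkQ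
      (orderedBoundary V n (Finsupp.single ρ 1))) = 0 :=
    (Submodule.Quotient.mk_eq_zero _).2 ⟨chainOf ρ, rfl⟩
  exact (congrArg (Representation.Coinvariants.mk (quotientRep G V n)) h).trans (map_zero _)

lemma coefficientClass_smul (g : G) (σ : OrderedSimplex V n) :
    coefficientClass G (g • σ) = coefficientClass G σ := by
  have h : quotientRep G V n g ((boundaries V n).mkQ (chainOf σ)) =
      (boundaries V n).mkQ (chainOf (g • σ)) := by
    rw [← chainRep_chainOf]
    rfl
  rw [coefficientClass, ← h, Representation.Coinvariants.mk_self_apply]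
  rfl

/-- A homomorphism on ordered chains that kills the alternation relators and the boundaries and is
invariant under the group factors through the coefficient group. -/
lemma exists_lift_orderedClass {A : Type*} [AddCommGroup A] (f : OrderedChain V n →ₗ[ℤ] A)
    (ha : ∀ t σ, f (alternationRelator t σ) = 0)
    (hb : ∀ ρ, f (orderedBoundary V n (Finsupp.single ρ 1)) = 0)
    (hg : ∀ (g : G) σ, f (Finsupp.single (g • σ) 1) = f (Finsupp.single σ 1)) :
    ∃ F : CoefficientGroup G V n →ₗ[ℤ] A, F ∘ₗ orderedClass G V n = f := by
  have h1 : alternation V n ≤ LinearMap.ker f := by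
    rw [alternation, Submodule.span_le]
    rintro _ ⟨⟨t, σ⟩, rfl⟩
    exact ha t σ
  have h2 : boundaries V n ≤ LinearMap.ker ((alternation V n).liftQ f h1) := by
    rw [LinearMap.range_le_ker_iff]
    refine Submodule.linearMap_qext _ (Finsupp.lhom_ext' fun ρ => LinearMap.ext_ring ?_)
    exact hb ρ
  refine ⟨Representation.Coinvariants.lift (quotientRep G V n)
    ((boundaries V n).liftQ ((alternation V n).liftQ f h1) h2) fun g => ?_, ?_⟩
  · refine Submodule.linearMap_qext _ (Submodule.linearMap_qext _
      (Finsupp.lhom_ext' fun σ => LinearMap.ext_ring ?_))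
    refine Eq.trans ?_ (hg g σ)
    refine congrArg f ?_
    exact orderedRep_single G V n g σ 1
  · rfl

end CoefficientPresentation

/-! ### Symbols as generators of the coefficient group, and the comparison with the Witt group -/

section SymbolPresentation

variable {K : Type u} [Field K]

variable (K) in
/-- The homomorphism sending the symbol of a triple of points to the class of the triple. -/
def symbolToCoefficient : (SquareClass K →₀ ℤ) →+ CoefficientGroup (PSL2 K) (P1 K) 2 :=
  Finsupp.liftAddHom fun c => zmultiplesHom _
    (coefficientClass (PSL2 K) (Function.surjInv tripleSymbol_surjective c))

/-- The triple chosen to represent a symbol lies in the orbit of `σ`, and coinvariants do not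
distinguish the two. -/
lemma symbolToCoefficient_single (σ : OrderedSimplex (P1 K) 2) :
    symbolToCoefficient K (Finsupp.single (tripleSymbol σ) 1) = coefficientClass (PSL2 K) σ := by
  obtain ⟨g, hg⟩ := (tripleSymbol_eq_iff _ _).1
    (Function.surjInv_eq tripleSymbol_surjective (tripleSymbol σ))
  conv_rhs => rw [← hg, coefficientClass_smul]
  simp [symbolToCoefficient]

lemma symbolToCoefficient_mapDomain (c : OrderedChain (P1 K) 2) :
    symbolToCoefficient K (Finsupp.mapDomain tripleSymbol c) =
      orderedClass (PSL2 K) (P1 K) 2 c := by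
  have h : (symbolToCoefficient K).comp (Finsupp.mapDomain.addMonoidHom tripleSymbol) =
      (orderedClass (PSL2 K) (P1 K) 2).toAddMonoidHom := by
    refine Finsupp.addHom_ext' fun σ => AddMonoidHom.ext_int ?_
    simp only [AddMonoidHom.comp_apply, Finsupp.singleAddHom_apply,
      Finsupp.mapDomain.addMonoidHom_apply, Finsupp.mapDomain_single]
    exact symbolToCoefficient_single σ
  exact DFunLike.congr_fun h c

lemma symbolToCoefficient_surjective : Function.Surjective (symbolToCoefficient K) := fun x => by
  obtain ⟨c, rfl⟩ := orderedClass_surjective x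
  exact ⟨_, symbolToCoefficient_mapDomain c⟩

/-- The coefficient group is presented by the symbols, the Witt relators and the sign relators. -/
theorem ker_symbolToCoefficient :
    (symbolToCoefficient K).ker = AddSubgroup.closure (wittRelators K ∪ signRelators K) := by
  apply le_antisymm
  · let π := QuotientAddGroup.mk' (AddSubgroup.closure (wittRelators K ∪ signRelators K))
    have hsign : AddSubgroup.closure (signRelators K) ≤
        AddSubgroup.closure (wittRelators K ∪ signRelators K) :=
      AddSubgroup.closure_mono Set.subset_union_right
    -- `F` goes back from the coefficient group to symbols modulo relators. An element of the
    -- kernel, lifted to an ordered chain, has class zero, so `F` shows that it lies in the subgroup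
    -- of relators.
    obtain ⟨F, hF⟩ := exists_lift_orderedClass (G := PSL2 K)
      (π.comp (Finsupp.mapDomain.addMonoidHom tripleSymbol)).toIntLinearMap
      (fun t σ => (QuotientAddGroup.eq_zero_iff _).2 (hsign (by
        rw [← closure_alternation_eq_closure_signRelators]
        exact AddSubgroup.subset_closure ⟨(t, σ), rfl⟩)))
      (fun ρ => (QuotientAddGroup.eq_zero_iff _).2 (AddSubgroup.subset_closure (Or.inl (by
        rw [← range_boundary_eq_wittRelators]
        exact ⟨ρ, rfl⟩))))
      (fun g σ => by
        simp [Finsupp.mapDomain_single, tripleSymbol_smul])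
    intro x hx
    obtain ⟨c, rfl⟩ := Finsupp.mapDomain_surjective tripleSymbol_surjective x
    rw [AddMonoidHom.mem_ker, symbolToCoefficient_mapDomain] at hx
    have h := LinearMap.congr_fun hF c
    rw [LinearMap.comp_apply, hx, map_zero] at h
    exact (QuotientAddGroup.eq_zero_iff _).1 h.symm
  · rw [AddSubgroup.closure_union, sup_le_iff, ← closure_alternation_eq_closure_signRelators,
      ← range_boundary_eq_wittRelators, AddSubgroup.closure_le, AddSubgroup.closure_le]
    constructor
    · rintro _ ⟨ρ, rfl⟩
      exact (symbolToCoefficient_mapDomain _).trans (orderedClass_boundary ρ)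
    · rintro _ ⟨⟨t, σ⟩, rfl⟩
      exact (symbolToCoefficient_mapDomain _).trans (orderedClass_alternationRelator t σ)

variable (K) in
/-- The isomorphism between the coefficient group and the Witt group. -/
def coefficientEquivWitt [Infinite K] : CoefficientGroup (PSL2 K) (P1 K) 2 ≃+ WittGroup K :=
  (QuotientAddGroup.quotientKerEquivOfSurjective _ symbolToCoefficient_surjective).symm.trans
    ((QuotientAddGroup.quotientAddEquivOfEq
      ((ker_symbolToCoefficient (K := K)).trans ker_toWitt.symm)).trans
      (QuotientAddGroup.quotientKerEquivOfSurjective _ toWitt_surjective))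

lemma coefficientEquivWitt_symbol [Infinite K] (a : Kˣ) :
    coefficientEquivWitt K (symbolToCoefficient K (symbol a)) =
      wittClass (BilinSpace.line a) := by
  have h : (QuotientAddGroup.quotientKerEquivOfSurjective _
      symbolToCoefficient_surjective).symm (symbolToCoefficient K (symbol a)) =
        QuotientAddGroup.mk (symbol a) :=
    (AddEquiv.symm_apply_eq _).2 rfl
  rw [coefficientEquivWitt, AddEquiv.trans_apply, h]
  exact toWitt_symbol a

end SymbolPresentation

end SimplexWitt

end

theorem theorem7p1 (K : Type u) [Field K] [Infinite K] :
    ∃ (sym : OrderedSimplex (P1 K) 2 → SquareClass K)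
      (q : (SquareClass K →₀ ℤ) →+ CoefficientGroup (PSL2 K) (P1 K) 2)
      (e : CoefficientGroup (PSL2 K) (P1 K) 2 ≃+ WittGroup K),
      -- the symbol of a triple of points, as a square class
      (∀ (σ : OrderedSimplex (P1 K) 2) (x y z : Fin 2 → K) (hx : x ≠ 0) (hy : y ≠ 0) (hz : z ≠ 0)
        (a : Kˣ), σ 0 = Projectivization.mk K x hx → σ 1 = Projectivization.mk K y hy →
          σ 2 = Projectivization.mk K z hz → (a : K) = det2 x y * det2 y z * det2 z x →
          sym σ = QuotientGroup.mk a) ∧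
      -- it identifies the orbits of triples with the square classes
      Function.Surjective sym ∧
      (∀ σ τ : OrderedSimplex (P1 K) 2, sym σ = sym τ ↔ ∃ g : PSL2 K, g • σ = τ) ∧
      -- the boundary relations, written in symbols
      (Set.range fun ρ : OrderedSimplex (P1 K) 3 =>
        Finsupp.mapDomain sym (orderedBoundary (P1 K) 2 (Finsupp.single ρ 1))) = wittRelators K ∧
      -- the alternation relations, written in symbols
      AddSubgroup.closure (Set.range fun p : Equiv.Perm (Fin 3) × OrderedSimplex (P1 K) 2 =>
        Finsupp.mapDomain sym (alternationRelator p.1 p.2)) =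
          AddSubgroup.closure (signRelators K) ∧
      -- presentation of the coefficient group by symbols and these relations
      (∀ σ : OrderedSimplex (P1 K) 2,
        q (Finsupp.single (sym σ) 1) = coefficientClass (PSL2 K) σ) ∧
      Function.Surjective q ∧
      q.ker = AddSubgroup.closure (wittRelators K ∪ signRelators K) ∧
      -- the isomorphism with the Witt group sends the symbol of `a` to the class of the form `⟨a⟩`
      (∀ a : Kˣ, e (q (symbol a)) = wittClass (BilinSpace.line a)) := by
  exact ⟨tripleSymbol, symbolToCoefficient K, coefficientEquivWitt K,
    fun σ x y z hx hy hz a h0 h1 h2 ha => tripleSymbol_eq h0 h1 h2 ha, tripleSymbol_surjective,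
    tripleSymbol_eq_iff, range_boundary_eq_wittRelators,
    closure_alternation_eq_closure_signRelators, symbolToCoefficient_single,
    symbolToCoefficient_surjective, ker_symbolToCoefficient, coefficientEquivWitt_symbol⟩
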